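/- **Setting.** A machine reads a binary program bit by bit from a one-way input tape, has an auxiliary input, and prints finite objects one after the other; its transitions are computable. Write $U_y(p)=x$ if $U$, with auxiliary input $y$, halts after reading exactly the bits of $p$ and having printed exactly $x$. Fix a universal machine $U$: for every machine $V$ there is a string $r$ such that for all $y,p$, $U$ with auxiliary input $y$ and program $rp$ simulates $V$ with auxiliary input $y$ and program $p$ (same halting outputs, same sequence of printed objects, reading past the end of the program in the same cases). Let $\mathbf m(x/y)=\sum\{2^{-\|p\|}:U_y(p)=x\}$. Identify the $n$-qubit space with $\mathbb C^{2^n}$. A vector or matrix is elementary if the real and imaginary parts of its entries are rational. Let $$\boldsymbol\mu=\boldsymbol\mu_n=\sum_{|\phi\rangle}\mathbf m(|\phi\rangle/n)\,|\phi\rangle\langle\phi|,$$ the sum being over all elementary unit vectors of the $n$-qubit space, and let $\mathbf H(\sigma)=\lceil-\log_2\operatorname{Tr}\boldsymbol\mu\sigma\rceil$. A program $q$ lower computes a positive semidefinite matrix $\nu$ if $U$ (with empty auxiliary input), reading no more than the bits of $q$ and with or without halting, prints a nonempty finite or infinite sequence of elementary positive semidefinite matrices that is increasing in the Loewner order and converges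 to $\nu$ (if finite, its last term is $\nu$). Let $\underline{\mathbf m}(\nu/n)$ be the sum of $\mathbf m(q/n)$ over all $q$ that lower compute $\nu$. Let $\mathcal C$ be the set of all lower computable matrices $A\otimes B$, where $A,B$ are positive semidefinite operators on the $n$-qubit space, with $\operatorname{Tr}(A\otimes B)(\boldsymbol\mu\otimes\boldsymbol\mu)\le1$, and let $$\mathfrak C=\mathfrak C_n=\sum_{\nu\in\mathcal C}\underline{\mathbf m}(\nu/n)\,\nu,\qquad \mathbf I(\sigma:\rho)=\log_2\operatorname{Tr}\mathfrak C(\sigma\otimes\rho).$$ For a unit vector $|\psi\rangle$ write $\mathbf H(|\psi\rangle)=\mathbf H(|\psi\rangle\langle\psi|)$ and $\mathbf I(|\psi\rangle:|\psi\rangle)=\mathbf I(|\psi\rangle\langle\psi|:|\psi\rangle\langle\psi|)$. Let $\Lambda=\Lambda_n$ be the uniform probability measure on the unit sphere of the $n$-qubit space. **Theorem.** The series defining $\boldsymbol\mu_n$ and $\mathfrak C_n$ converge for every $n\ge0$, and there are constants $c,C>0$, depending only on $U$, such that for all $n\ge 0$: 1. $|\mathbf H(2^{-n}I)-n|\le C$;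 2. $|\mathbf I(2^{-n}I:2^{-n}I)|\le C$; 3. $|\psi\rangle\mapsto2^{-\mathbf H(|\psi\rangle)}$ is $\Lambda$-integrable and $c\,2^{-n}\le\int2^{-\mathbf H(|\psi\rangle)}\,d\Lambda\le C\,2^{-n}$; 4. $|\psi\rangle\mapsto2^{\mathbf I(|\psi\rangle:|\psi\rangle)}$ is $\Lambda$-integrable and $\int2^{\mathbf I(|\psi\rangle:|\psi\rangle)}\,d\Lambda\le C$. Consequently most pure states have negligible self-information: there is a constant $C'$, depending only on $U$, such that $\Lambda\{|\psi\rangle:\mathbf I(|\psi\rangle:|\psi\rangle)\ge t\}\le C'2^{-t}$ for all $n\ge0$ and all real $t$. -/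

import Mathlib

open MeasureTheory Topology
open scoped ENNReal Kronecker ComplexOrder

noncomputable section

namespace QInfo

/-! ### Machines

Programs are binary strings on a one-way input tape.  Auxiliary inputs and printed items are
finite objects, coded as natural numbers in the usual way. -/

/-- One instruction: halt, pass silently to a new state, print an item, or read the next bit of the
program (passing to the first state on `false` and to the second one on `true`). -/
inductive Instr : Type
  | halt : Instr
  | silent (s : ℕ) : Instr
  | print (w s : ℕ) : Instr
  | read (s₀ s₁ : ℕ) : Instr

/-- Instructions as a sum type, used only to say what a computable map into `Instr` is. -/
def Instr.equivSum : Instr ≃ Unit ⊕ ℕ ⊕ (ℕ × ℕ) ⊕ (ℕ × ℕ) where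
  toFun
    | .halt => .inl ()
    | .silent s => .inr (.inl s)
    | .print w s => .inr (.inr (.inl (w, s)))
    | .read s₀ s₁ => .inr (.inr (.inr (s₀, s₁)))
  invFun
    | .inl _ => .halt
    | .inr (.inl s) => .silent s
    | .inr (.inr (.inl (w, s))) => .print w s
    | .inr (.inr (.inr (s₀, s₁))) => .read s₀ s₁
  left_inv := by rintro (_ | _ | _ | _) <;> rfl
  right_inv := by rintro (_ | _ | ⟨_, _⟩ | ⟨_, _⟩) <;> rfl

instance : Primcodable Instr := Primcodable.ofEquiv _ Instr.equivSum

/-- A machine with a one-way binary program tape, an auxiliary input and a one-way output, given by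
its computable initial state (a function of the auxiliary input) and transition function. -/
structure Machine where
  init : ℕ → ℕ
  next : ℕ → Instr
  computable_init : Computable init
  computable_next : Computable next

/-- A configuration: internal state, unread part of the program, items printed so far. -/
structure Config where
  state : ℕ
  unread : List Bool
  printed : List ℕ

namespace Machine

/-- One step.  A configuration does not change any more once the machine has halted, or once it
tries to read past the end of the program. -/
def step (M : Machine) (c : Config) : Config :=
  match M.next c.state with
  | .halt => c
  | .silent s => { c with state := s }
  | .print w s => { c with state := s, printed := c.printed ++ [w] }
  | .read s₀ s₁ =>
    match c.unread with
    | [] => c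
    | b :: l => { c with state := if b then s₁ else s₀, unread := l }

/-- The configuration after `t` steps with auxiliary input `y` and program `p`. -/
def run (M : Machine) (y : ℕ) (p : List Bool) (t : ℕ) : Config :=
  M.step^[t] ⟨M.init y, p, []⟩

/-- `M_y(p) = x`: the machine halts having read exactly the bits of `p` and printed exactly `x`. -/
def Outputs (M : Machine) (y : ℕ) (p : List Bool) (x : ℕ) : Prop :=
  ∃ t, M.next (M.run y p t).state = .halt ∧ (M.run y p t).unread = [] ∧
    (M.run y p t).printed = [x]

/-- With or without halting, item number `k` (counted from `0`) that the machine prints is `w`. -/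
def Prints (M : Machine) (y : ℕ) (p : List Bool) (k w : ℕ) : Prop :=
  ∃ t, (M.run y p t).printed[k]? = some w

/-- The machine tries to read more bits than `p` has. -/
def ReadsBeyond (M : Machine) (y : ℕ) (p : List Bool) : Prop :=
  ∃ t s₀ s₁, M.next (M.run y p t).state = .read s₀ s₁ ∧ (M.run y p t).unread = []

/-- `U` is universal: every machine `V` is simulated by `U` with the help of a fixed prefix `r`. -/
def Universal (U : Machine) : Prop :=
  ∀ V : Machine, ∃ r : List Bool, ∀ (y : ℕ) (p : List Bool),
    (∀ x, U.Outputs y (r ++ p) x ↔ V.Outputs y p x) ∧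
    (∀ k w, U.Prints y (r ++ p) k w ↔ V.Prints y p k w) ∧
    (U.ReadsBeyond y (r ++ p) ↔ V.ReadsBeyond y p)

end Machine

/-- The algorithmic probability `m(x / y) = ∑ { 2^(-|p|) : U_y(p) = x }`. -/
def algProb (U : Machine) (x y : ℕ) : ℝ≥0∞ :=
  ∑' p : {p : List Bool // U.Outputs y p x}, (2⁻¹ : ℝ≥0∞) ^ p.1.length

/-! ### Elementary states and matrices -/

/-- The complex number with given rational real and imaginary part. -/
def toC (z : ℚ × ℚ) : ℂ := ⟨(z.1 : ℝ), (z.2 : ℝ)⟩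

/-- Numerators and denominators of the two components. -/
def entry (z : ℚ × ℚ) : (ℤ × ℕ) × (ℤ × ℕ) := ((z.1.num, z.1.den), (z.2.num, z.2.den))

/-- The code of a vector: its list of coordinates. -/
def codeVec {N : ℕ} (v : Fin N → ℚ × ℚ) : ℕ :=
  Encodable.encode ((List.ofFn v).map entry)

/-- The code of a square matrix: its list of rows. -/
def codeMat {N : ℕ} (A : Matrix (Fin N) (Fin N) (ℚ × ℚ)) : ℕ :=
  Encodable.encode ((List.ofFn fun i => A i).map fun row => (List.ofFn row).map entry)

/-- Elementary pure states: unit vectors all of whose coordinates have rational real and imaginary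
parts. -/
def ElemState (N : ℕ) : Type :=
  {v : Fin N → ℚ × ℚ // ∑ i, ((v i).1 ^ 2 + (v i).2 ^ 2) = 1}

/-- The vector of an elementary state. -/
def ElemState.vec {N : ℕ} (φ : ElemState N) : Fin N → ℂ := fun i => toC (φ.1 i)

/-- The operator `|v⟩⟨v|`. -/
def ketbra {N : ℕ} (v : Fin N → ℂ) : Matrix (Fin N) (Fin N) ℂ := Matrix.vecMulVec v (star v)

/-! ### The universal semi-density matrix and entropy

The `n`-qubit space is `ℂ^(2^n)`; its computational basis is indexed by `Fin (2 ^ n)`. -/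

/-- The terms `m(|φ⟩ / n) |φ⟩⟨φ|`. -/
def muTerm (U : Machine) (n : ℕ) (φ : ElemState (2 ^ n)) :
    Matrix (Fin (2 ^ n)) (Fin (2 ^ n)) ℂ :=
  (algProb U (codeVec φ.1) n).toReal • ketbra φ.vec

/-- The universal semi-density matrix `μ` on `n` qubits. -/
def mu (U : Machine) (n : ℕ) : Matrix (Fin (2 ^ n)) (Fin (2 ^ n)) ℂ :=
  ∑' φ : ElemState (2 ^ n), muTerm U n φ

/-- The algorithmic entropy `H(σ) = ⌈-log₂ Tr μσ⌉`. -/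
def entropy (U : Machine) {n : ℕ} (σ : Matrix (Fin (2 ^ n)) (Fin (2 ^ n)) ℂ) : ℤ :=
  ⌈-Real.logb 2 (mu U n * σ).trace.re⌉

/-! ### Lower computable matrices, tests and information -/

/-- The program `q` lower computes `σ`: without reading past the end of `q`, `U` prints a
nonempty, finite or infinite, sequence of elementary positive semidefinite matrices that increases
in the Loewner order and converges to `σ` (if it is finite: ends with `σ`). -/
def LowerComputes (U : Machine) (q : List Bool) {N : ℕ} (σ : Matrix (Fin N) (Fin N) ℂ) : Prop :=
  ¬ U.ReadsBeyond 0 q ∧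
  (∀ k w, U.Prints 0 q k w →
    ∃ E : Matrix (Fin N) (Fin N) (ℚ × ℚ), w = codeMat E ∧ (E.map toC).PosSemidef) ∧
  (∀ (k : ℕ) (E F : Matrix (Fin N) (Fin N) (ℚ × ℚ)),
    U.Prints 0 q k (codeMat E) → U.Prints 0 q (k + 1) (codeMat F) →
      (F.map toC - E.map toC).PosSemidef) ∧
  (∀ V ∈ 𝓝 σ, ∃ k₀, (∃ w, U.Prints 0 q k₀ w) ∧
    ∀ k ≥ k₀, ∀ E : Matrix (Fin N) (Fin N) (ℚ × ℚ),
      U.Prints 0 q k (codeMat E) → E.map toC ∈ V)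

/-- Operators on the tensor square of `ℂ^d`, with basis `|i⟩|j⟩`. -/
abbrev PairMatrix (d : ℕ) : Type := Matrix (Fin d × Fin d) (Fin d × Fin d) ℂ

/-- The same operator with the basis `|i⟩|j⟩` in lexicographic order. -/
def flatten {d : ℕ} (M : PairMatrix d) : Matrix (Fin (d * d)) (Fin (d * d)) ℂ :=
  Matrix.reindex finProdFinEquiv finProdFinEquiv M

/-- The lower algorithmic probability of `M` given `n`:
the sum of `m(q / n)` over all programs `q` that lower compute `M`. -/
def lowerProb (U : Machine) {d : ℕ} (M : PairMatrix d) (n : ℕ) : ℝ≥0∞ :=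
  ∑' q : {q : List Bool // LowerComputes U q (flatten M)}, algProb U (Encodable.encode q.1) n

/-- The product tests: lower computable matrices `A ⊗ B` with `Tr (A ⊗ B)(μ ⊗ μ) ≤ 1`. -/
def productTests (U : Machine) (n : ℕ) : Set (PairMatrix (2 ^ n)) :=
  {M | (∃ A B : Matrix (Fin (2 ^ n)) (Fin (2 ^ n)) ℂ,
          A.PosSemidef ∧ B.PosSemidef ∧ M = A ⊗ₖ B) ∧
       (∃ q, LowerComputes U q (flatten M)) ∧
       (M * (mu U n ⊗ₖ mu U n)).trace.re ≤ 1}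

/-- The terms of the aggregated test: product tests weighted by lower probability. -/
def testTerm (U : Machine) (n : ℕ) (M : productTests U n) : PairMatrix (2 ^ n) :=
  (lowerProb U M.1 n).toReal • M.1

/-- The aggregation of all product tests. -/
def aggTest (U : Machine) (n : ℕ) : PairMatrix (2 ^ n) :=
  ∑' M : productTests U n, testTerm U n M

/-- The mutual information `I(σ : ρ)`: the logarithm of the trace of the aggregated test against
`σ ⊗ ρ`. -/
def info (U : Machine) {n : ℕ} (σ ρ : Matrix (Fin (2 ^ n)) (Fin (2 ^ n)) ℂ) : ℝ :=
  Real.logb 2 (aggTest U n * (σ ⊗ₖ ρ)).trace.re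

/-! ### The maximally mixed state, pure states, and the uniform distribution -/

/-- The maximally mixed state `2^(-n) I`. -/
def maxMixed (n : ℕ) : Matrix (Fin (2 ^ n)) (Fin (2 ^ n)) ℂ := ((2 : ℂ) ^ n)⁻¹ • 1

/-- The unit sphere of the `n`-qubit space. -/
abbrev QSphere (n : ℕ) : Type := Metric.sphere (0 : EuclideanSpace ℂ (Fin (2 ^ n))) 1

/-- The density matrix `|ψ⟩⟨ψ|` of a unit vector. -/
def pureState {n : ℕ} (ψ : QSphere n) : Matrix (Fin (2 ^ n)) (Fin (2 ^ n)) ℂ :=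
  ketbra fun i => ψ.1 i

/-- The uniform distribution on the unit sphere: normalized surface measure. -/
def uniformSphere (n : ℕ) : Measure (QSphere n) :=
  ((volume : Measure (EuclideanSpace ℂ (Fin (2 ^ n)))).toSphere Set.univ)⁻¹ •
    (volume : Measure (EuclideanSpace ℂ (Fin (2 ^ n)))).toSphere

end QInfo

end

noncomputable section

namespace QInfo

/-! ### Runs of machines and the Kraft inequality -/

namespace Machine

/-! Everything is decided up to constant factors by comparing `mu` and `aggTest` with the identity.
Programs with an output form a prefix-free set, so Kraft's inequality makes the weights in both
series sum to at most 1 (`tsum_algProb_le_one`, `tsum_lowerProb_le_one`). A linear functional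
bounded by `K ≥ 0` on the terms is then bounded by `K` on the sum (`linearMap_mu_le`,
`linearMap_aggTest_le`).

Universality gives lower bounds. Given `n`, every basis vector has a program of length `n + O(1)`,
so `mu` dominates the identity times `2^(-n-k)` when traced against positive semidefinite matrices
(`exists_le_trace_mu_mul`). The identity on pairs is a product test with lower probability bounded
below, so `aggTest` dominates a constant multiple of it (`exists_le_linearMap_aggTest`).

The first domination turns the test condition into `Tr A * Tr B ≤ 2^(2(k+n))`
(`exists_trace_productTests_le`). This yields convergence of the aggregated test and cancels the
factors `2^(-n)` of the two mixed states. For pure states the same cancellation needs the mean of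
`⟨ψ|A|ψ⟩⟨ψ|B|ψ⟩` to be at most `2 * 2^(-2n) * Tr A * Tr B` (`meanPairTrace_kronecker_le`). This
follows from unitary invariance of the sphere measure and a polarization identity for fourth powers.
The tail bound is Markov's inequality. -/

theorem run_succ (M : Machine) (y : ℕ) (p : List Bool) (t : ℕ) :
    M.run y p (t + 1) = M.step (M.run y p t) :=
  Function.iterate_succ_apply' _ _ _

theorem run_eq_of_step_eq {M : Machine} {y : ℕ} {p : List Bool} {t : ℕ}
    (h : M.step (M.run y p t) = M.run y p t) {t' : ℕ} (ht : t ≤ t') :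
    M.run y p t' = M.run y p t := by
  induction t', ht using Nat.le_induction with
  | base => rfl
  | succ k _ ih => rw [run_succ, ih, h]

theorem run_eq_of_halt {M : Machine} {y : ℕ} {p : List Bool} {t : ℕ}
    (h : M.next (M.run y p t).state = .halt) {t' : ℕ} (ht : t ≤ t') :
    M.run y p t' = M.run y p t :=
  run_eq_of_step_eq (by simp [step, h]) ht

/-- The tape is one-way, so appended bits stay invisible until `p` is exhausted. The second
alternative is a run stuck at the end of `p`. -/
theorem run_append (M : Machine) (y : ℕ) (p s : List Bool) (t : ℕ) :
    M.run y (p ++ s) t = { M.run y p t with unread := (M.run y p t).unread ++ s } ∨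
      ((M.run y p t).unread = [] ∧ ∃ s₀ s₁, M.next (M.run y p t).state = .read s₀ s₁) := by
  induction t with
  | zero => left; rfl
  | succ t ih =>
    rw [run_succ, run_succ]
    rcases ih with ih | ⟨h, s₀, s₁, hn⟩
    · rw [ih]
      generalize M.run y p t = c
      rcases c with ⟨q, u, w⟩
      rcases hn : M.next q with _ | _ | _ | ⟨s₀, s₁⟩
      · left; simp [step, hn]
      · left; simp [step, hn]
      · left; simp [step, hn]
      · rcases u with _ | ⟨b, u⟩
        · right; simp [step, hn]
        · left; simp [step, hn]
    · right
      have : M.step (M.run y p t) = M.run y p t := by simp [step, hn, h]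
      rw [this]
      exact ⟨h, s₀, s₁, hn⟩

/-- The programs with which a machine has an output form a prefix-free set, and the output is
unique. -/
theorem Outputs.append_eq_nil {M : Machine} {y : ℕ} {p s : List Bool} {x x' : ℕ}
    (h : M.Outputs y p x) (h' : M.Outputs y (p ++ s) x') : s = [] ∧ x = x' := by
  obtain ⟨t, ht, hu, hp⟩ := h
  obtain ⟨t', ht', hu', hp'⟩ := h'
  rcases M.run_append y p s t with hr | ⟨-, s₀, s₁, hn⟩
  · have e1 : M.run y (p ++ s) (max t t') = M.run y (p ++ s) t :=
      run_eq_of_halt (by rw [hr]; exact ht) (le_max_left _ _)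
    have e2 : M.run y (p ++ s) (max t t') = M.run y (p ++ s) t' :=
      run_eq_of_halt ht' (le_max_right _ _)
    have e3 := e1.symm.trans e2
    rw [hr] at e3
    constructor
    · have := congrArg Config.unread e3
      simpa [hu, hu'] using this
    · have := congrArg Config.printed e3
      simpa [hp, hp'] using this
  · rw [hn] at ht; cases ht

theorem Outputs.unique {M : Machine} {y : ℕ} {p : List Bool} {x x' : ℕ}
    (h : M.Outputs y p x) (h' : M.Outputs y p x') : x = x' :=
  (Outputs.append_eq_nil (s := []) h (by simpa using h')).2

end Machine

/-- Of the first words of two equal concatenations one is a prefix of the other, so they agree and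
can be cancelled. The empty word is excluded because repeating it changes nothing in the
concatenation. -/
theorem uniquelyDecodable_of_prefixFree {α : Type*} {S : Set (List α)} (h0 : [] ∉ S)
    (h : ∀ p s, p ∈ S → p ++ s ∈ S → s = []) : InformationTheory.UniquelyDecodable S := by
  intro L₁
  induction L₁ with
  | nil =>
    rintro (_ | ⟨b, L₂⟩) - h2 he
    · rfl
    · have : b = [] := by simp at he; exact he.1
      exact absurd (this ▸ h2 b (by simp)) h0
  | cons a L₁ ih =>
    rintro (_ | ⟨b, L₂⟩) h1 h2 he
    · have : a = [] := by simp at he; exact he.1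
      exact absurd (this ▸ h1 a (by simp)) h0
    · have ha := h1 a (by simp)
      have hb := h2 b (by simp)
      simp only [List.flatten_cons] at he
      have hab : a = b := by
        rcases List.append_eq_append_iff.1 he with ⟨s, h1, -⟩ | ⟨s, h1, -⟩
        · have := h a s ha (h1 ▸ hb); simp [h1, this]
        · have := h b s hb (h1 ▸ ha); simp [h1, this]
      subst hab
      rw [ih L₂ (fun w hw => h1 w (by simp [hw])) (fun w hw => h2 w (by simp [hw]))
        (List.append_cancel_left he)]

/-- The Kraft inequality for prefix-free sets of binary strings. -/
theorem tsum_two_pow_length_le_one {S : Set (List Bool)}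
    (h : ∀ p s, p ∈ S → p ++ s ∈ S → s = []) :
    ∑' p : S, (2⁻¹ : ℝ≥0∞) ^ p.1.length ≤ 1 := by
  -- The set `{[]}` is prefix-free but not uniquely decodable; its sum is exactly 1.
  by_cases h0 : [] ∈ S
  · have hS : S = {[]} := by
      ext p
      refine ⟨fun hp => h [] p h0 hp, ?_⟩
      rintro rfl
      exact h0
    subst hS
    rw [tsum_singleton (α := ℝ≥0∞) [] (fun p : List Bool => (2⁻¹ : ℝ≥0∞) ^ p.length)]
    simp
  · rw [ENNReal.tsum_eq_iSup_sum]
    refine iSup_le fun F => ?_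
    have hk := InformationTheory.kraft_mcmillan_inequality
      (S := F.map (Function.Embedding.subtype _))
      (uniquelyDecodable_of_prefixFree (by simp [h0]) (fun p s hp hs => by
        simp at hp hs
        exact h p s hp.1 hs.1))
    rw [Finset.sum_map] at hk
    have : ∑ p ∈ F, (2⁻¹ : ℝ≥0∞) ^ p.1.length
        = ENNReal.ofReal (∑ p ∈ F, (1 / Fintype.card Bool : ℝ) ^ p.1.length) := by
      rw [ENNReal.ofReal_sum_of_nonneg (fun _ _ => by positivity)]
      refine Finset.sum_congr rfl fun p _ => ?_
      rw [ENNReal.ofReal_pow (by positivity)]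
      simp [ENNReal.ofReal_inv_of_pos]
    rw [this]
    exact ENNReal.ofReal_le_one.2 hk

/-- For fixed auxiliary input, the algorithmic probability is a semi-measure. -/
theorem tsum_algProb_le_one (U : Machine) (y : ℕ) : ∑' x, algProb U x y ≤ 1 := by
  unfold algProb
  rw [← ENNReal.tsum_sigma (fun x (p : {p : List Bool // U.Outputs y p x}) =>
    (2⁻¹ : ℝ≥0∞) ^ p.1.length)]
  -- Outputs are unique, so the programs for different `x` are disjoint and the double sum runs over
  -- a single prefix-free set.
  let S : Set (List Bool) := {p | ∃ x, U.Outputs y p x}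
  let f : (Σ x, {p : List Bool // U.Outputs y p x}) → S := fun a => ⟨a.2.1, a.1, a.2.2⟩
  have hf : Function.Injective f := by
    rintro ⟨x, p, hp⟩ ⟨x', p', hp'⟩ h
    have h1 : p = p' := congrArg Subtype.val h
    subst h1
    obtain rfl := hp.unique hp'
    rfl
  refine (ENNReal.tsum_comp_le_tsum_of_injective hf
    (fun p : S => (2⁻¹ : ℝ≥0∞) ^ p.1.length)).trans (tsum_two_pow_length_le_one ?_)
  rintro p s ⟨x, hx⟩ ⟨x', hx'⟩
  exact (hx.append_eq_nil hx').1

theorem tsum_algProb_comp_le_one (U : Machine) (y : ℕ) {ι : Type*} {f : ι → ℕ}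
    (hf : Function.Injective f) : ∑' i, algProb U (f i) y ≤ 1 :=
  (ENNReal.tsum_comp_le_tsum_of_injective hf _).trans (tsum_algProb_le_one U y)

theorem Machine.Outputs.le_algProb {U : Machine} {x y : ℕ} {p : List Bool} (h : U.Outputs y p x) :
    (2⁻¹ : ℝ≥0∞) ^ p.length ≤ algProb U x y :=
  ENNReal.le_tsum (f := fun p : {p : List Bool // U.Outputs y p x} =>
    (2⁻¹ : ℝ≥0∞) ^ p.1.length) ⟨p, h⟩

/-! ### Decision-tree machines -/

/-- The states of a decision-tree machine are `0` (halt) and `s + 1`, where `g s` says whether to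
print an item and halt or to read a bit. -/
def treeNext (g : ℕ → ℕ ⊕ ℕ × ℕ) : ℕ → Instr
  | 0 => .halt
  | s + 1 => (g s).elim (fun w => .print w 0) (fun ab => .read (ab.1 + 1) (ab.2 + 1))

theorem computable_treeNext {g : ℕ → ℕ ⊕ ℕ × ℕ} (hg : Computable g) :
    Computable (treeNext g) := by
  have hz : Computable₂ fun (_ s : ℕ) => Instr.equivSum.symm
      ((g s).elim (fun w => .inr (.inr (.inl (w, 0))))
        (fun ab => .inr (.inr (.inr (ab.1 + 1, ab.2 + 1))))) := by
    refine Computable.comp (g := fun p : ℕ × ℕ => _)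
      (Primrec.of_equiv_symm (e := Instr.equivSum)).to_comp ?_
    refine Computable.sumCasesOn (hg.comp Computable.snd) ?_ ?_
    · exact (Primrec.sumInr.comp (Primrec.sumInr.comp (Primrec.sumInl.comp
        (Primrec.snd.pair (Primrec.const 0))))).to_comp
    · exact (Primrec.sumInr.comp (Primrec.sumInr.comp (Primrec.sumInr.comp
        ((Primrec.succ.comp (Primrec.fst.comp Primrec.snd)).pair
          (Primrec.succ.comp (Primrec.snd.comp Primrec.snd)))))).to_comp
  refine (Computable.nat_casesOn Computable.id (Computable.const Instr.halt)
    hz).of_eq ?_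
  rintro (_ | s)
  · rfl
  · simp only [treeNext, id]
    rcases g s with w | ab <;> rfl

/-- The machine of a computable decision tree. -/
def treeMachine (i : ℕ → ℕ) (g : ℕ → ℕ ⊕ ℕ × ℕ) (hi : Computable i) (hg : Computable g) :
    Machine where
  init y := i y + 1
  next := treeNext g
  computable_init := Computable.succ.comp hi
  computable_next := computable_treeNext hg

/-- Reading `p` leads from node `s` of a decision tree to a leaf with label `w`. -/
inductive TreePath (g : ℕ → ℕ ⊕ ℕ × ℕ) (w : ℕ) : ℕ → List Bool → Prop
  | leaf {s : ℕ} (h : g s = .inl w) : TreePath g w s []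
  | node {s a b : ℕ} {c : Bool} {p : List Bool} (h : g s = .inr (a, b))
      (hp : TreePath g w (if c then b else a) p) : TreePath g w s (c :: p)

section Tree

variable {i : ℕ → ℕ} {g : ℕ → ℕ ⊕ ℕ × ℕ} (hi : Computable i) (hg : Computable g)

/-- Each step inside the tree consumes one bit, so nothing is printed and no read meets an empty
tape up to time `p.length`; the next step prints the label. The starting node is arbitrary for the
sake of the induction. -/
theorem TreePath.iterate {s w : ℕ} {p : List Bool} (h : TreePath g w s p) :
    (∀ t ≤ p.length, ((treeMachine i g hi hg).step^[t] ⟨s + 1, p, []⟩).printed = [] ∧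
      ∀ s₀ s₁, treeNext g ((treeMachine i g hi hg).step^[t] ⟨s + 1, p, []⟩).state = .read s₀ s₁ →
        ((treeMachine i g hi hg).step^[t] ⟨s + 1, p, []⟩).unread ≠ []) ∧
    (treeMachine i g hi hg).step^[p.length + 1] ⟨s + 1, p, []⟩ = ⟨0, [], [w]⟩ := by
  induction h with
  | leaf h => simp [Machine.step, treeMachine, treeNext, h]
  | @node s a b c p h hp ih =>
    have hs : (treeMachine i g hi hg).step ⟨s + 1, c :: p, []⟩ =
        ⟨(if c then b else a) + 1, p, []⟩ := by
      cases c <;> simp [Machine.step, treeMachine, treeNext, h]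
    constructor
    · rintro (_ | t) ht
      · simp
      · rw [Function.iterate_succ_apply, hs]
        exact ih.1 t (by simpa using ht)
    · rw [List.length_cons, Function.iterate_succ_apply, hs]
      exact ih.2

theorem TreePath.run {y w : ℕ} {p : List Bool} (h : TreePath g w (i y) p) :
    (treeMachine i g hi hg).run y p (p.length + 1) = ⟨0, [], [w]⟩ :=
  (h.iterate hi hg).2

theorem TreePath.run_of_lt {y w : ℕ} {p : List Bool} (h : TreePath g w (i y) p) {t : ℕ}
    (ht : p.length < t) : (treeMachine i g hi hg).run y p t = ⟨0, [], [w]⟩ := by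
  rw [← h.run hi hg]
  exact Machine.run_eq_of_halt (by rw [h.run hi hg]; rfl) ht

theorem TreePath.outputs {y w : ℕ} {p : List Bool} (h : TreePath g w (i y) p) :
    (treeMachine i g hi hg).Outputs y p w :=
  ⟨p.length + 1, by rw [h.run hi hg]; exact ⟨rfl, rfl, rfl⟩⟩

theorem TreePath.prints {y w : ℕ} {p : List Bool} (h : TreePath g w (i y) p) (k w' : ℕ) :
    (treeMachine i g hi hg).Prints y p k w' ↔ k = 0 ∧ w' = w := by
  constructor
  · rintro ⟨t, ht⟩
    rcases le_or_gt t p.length with hl | hl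
    · have := ((h.iterate hi hg).1 t hl).1
      rw [Machine.run] at ht
      rw [show (treeMachine i g hi hg).init y = i y + 1 from rfl, this] at ht
      simp at ht
    · rw [h.run_of_lt hi hg hl] at ht
      rcases k with _ | k
      · simpa [eq_comm] using ht
      · simp at ht
  · rintro ⟨rfl, rfl⟩
    exact ⟨p.length + 1, by rw [h.run hi hg]; rfl⟩

theorem TreePath.not_readsBeyond {y w : ℕ} {p : List Bool} (h : TreePath g w (i y) p) :
    ¬ (treeMachine i g hi hg).ReadsBeyond y p := by
  rintro ⟨t, s₀, s₁, hn, hu⟩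
  rcases le_or_gt t p.length with hl | hl
  · exact ((h.iterate hi hg).1 t hl).2 s₀ s₁ hn hu
  · rw [h.run_of_lt hi hg hl] at hn
    cases hn

end Tree

/-! ### Codes of basis vectors and of the identity matrix -/

theorem entry_injective : Function.Injective entry := by
  rintro ⟨a, b⟩ ⟨c, d⟩ h
  simp only [entry, Prod.mk.injEq] at h
  exact Prod.ext (Rat.ext h.1.1 h.1.2) (Rat.ext h.2.1 h.2.2)

theorem codeVec_injective {N : ℕ} : Function.Injective (codeVec (N := N)) := fun _ _ h =>
  List.ofFn_injective (List.map_injective_iff.2 entry_injective (Encodable.encode_injective h))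

theorem codeMat_injective {N : ℕ} : Function.Injective (codeMat (N := N)) := by
  intro A B h
  have h1 := Encodable.encode_injective h
  refine List.ofFn_injective (List.map_injective_iff.2 (fun u v huv => ?_) h1)
  exact List.ofFn_injective (List.map_injective_iff.2 entry_injective huv)

/-- The code of a list depends only on the codes of its entries. Codes of rational vectors thus
become codes of lists of naturals, for which primitive recursiveness is easy to prove. -/
theorem encode_map {α β : Type*} [Encodable β] (f : α → β) (l : List α) :
    Encodable.encode (l.map f) = Encodable.encode (l.map fun a => Encodable.encode (f a)) := by
  induction l with
  | nil => rfl
  | cons a l ih => simp [ih]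

/-- The standard basis vector, with rational coordinates. -/
def ratBasis {N : ℕ} (j : Fin N) : Fin N → ℚ × ℚ := fun i => if i = j then (1, 0) else (0, 0)

/-- The identity matrix, with rational coordinates. -/
def ratId (N : ℕ) : Matrix (Fin N) (Fin N) (ℚ × ℚ) := fun i j => ratBasis i j

/-- The code of the `j`-th standard basis vector of dimension `N`. -/
def basisCode (N j : ℕ) : ℕ :=
  Encodable.encode ((List.range N).map fun i =>
    if i = j then Encodable.encode (entry (1, 0)) else Encodable.encode (entry (0, 0)))

/-- The code of the identity matrix of size `N`. -/
def idCode (N : ℕ) : ℕ := Encodable.encode ((List.range N).map fun i => basisCode N i)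

theorem ofFn_eq_map_range {α : Type*} (N : ℕ) (f : ℕ → α) :
    List.ofFn (fun i : Fin N => f i) = (List.range N).map f := by
  apply List.ext_getElem <;> simp

/-- Trades the dependent index in `Fin N` for a function of two naturals that can be shown primitive
recursive. -/
theorem codeVec_ratBasis {N : ℕ} (j : Fin N) : codeVec (ratBasis j) = basisCode N j := by
  unfold codeVec basisCode ratBasis
  have : (fun i : Fin N => if i = j then ((1 : ℚ), (0 : ℚ)) else (0, 0)) =
      fun i : Fin N => (fun i : ℕ => if i = (j : ℕ) then ((1 : ℚ), (0 : ℚ)) else (0, 0)) i := by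
    ext1 i; simp [Fin.ext_iff]
  rw [this, ofFn_eq_map_range N fun i : ℕ => if i = (j : ℕ) then ((1 : ℚ), (0 : ℚ)) else (0, 0),
    List.map_map, encode_map]
  congr 2
  ext1 i
  simp only [Function.comp]
  split_ifs <;> rfl

theorem codeMat_ratId (N : ℕ) : codeMat (ratId N) = idCode N := by
  unfold codeMat idCode
  rw [encode_map, List.map_ofFn, ← ofFn_eq_map_range]
  congr 2
  ext1 i
  exact codeVec_ratBasis i

theorem primrec_basisCode : Primrec₂ basisCode := by
  refine Primrec.encode.comp (Primrec.list_map (Primrec.list_range.comp Primrec.fst) ?_)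
  exact Primrec.ite (Primrec.eq.comp Primrec.snd (Primrec.snd.comp Primrec.fst))
    (Primrec.const _) (Primrec.const _)

theorem primrec_idCode : Primrec idCode := by
  refine Primrec.encode.comp (Primrec.list_map Primrec.list_range ?_)
  exact primrec_basisCode.comp Primrec.fst Primrec.snd

theorem primrec_two_pow : Primrec fun n : ℕ => 2 ^ n := by
  refine (Primrec.nat_rec' (f := id) Primrec.id (Primrec.const 1)
    (h := fun _ p => 2 * p.2) ?_).of_eq fun n => ?_
  · exact Primrec.nat_mul.comp (Primrec.const 2) (Primrec.snd.comp Primrec.snd)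
  · induction n with
    | zero => rfl
    | succ n ih => simp only [id] at ih ⊢; rw [pow_succ, ← ih, mul_comm]

/-! ### Universal machines -/

theorem Machine.Universal.exists_outputs {U : Machine} (hU : U.Universal) {i : ℕ → ℕ}
    {g : ℕ → ℕ ⊕ ℕ × ℕ} (hi : Computable i) (hg : Computable g) :
    ∃ r : List Bool, ∀ y w p, TreePath g w (i y) p → U.Outputs y (r ++ p) w := by
  obtain ⟨r, hr⟩ := hU (treeMachine i g hi hg)
  exact ⟨r, fun y w p h => ((hr y p).1 w).2 (h.outputs hi hg)⟩

/-- The decision tree that, on input `n`, reads `n` bits and prints the code of the corresponding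
basis vector.  States are triples `(bits to read, n, number read so far)`. -/
def basisTree (s : ℕ) : ℕ ⊕ ℕ × ℕ :=
  if s.unpair.1 = 0 then .inl (basisCode (2 ^ s.unpair.2.unpair.1) s.unpair.2.unpair.2)
  else .inr
    (Nat.pair (s.unpair.1 - 1) (Nat.pair s.unpair.2.unpair.1 (2 * s.unpair.2.unpair.2)),
      Nat.pair (s.unpair.1 - 1) (Nat.pair s.unpair.2.unpair.1 (2 * s.unpair.2.unpair.2 + 1)))

theorem primrec_basisTree : Primrec basisTree := by
  have h1 : Primrec fun s : ℕ => s.unpair.1 := Primrec.fst.comp Primrec.unpair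
  have h2 : Primrec fun s : ℕ => s.unpair.2 := Primrec.snd.comp Primrec.unpair
  have h21 : Primrec fun s : ℕ => s.unpair.2.unpair.1 := h1.comp h2
  have h22 : Primrec fun s : ℕ => s.unpair.2.unpair.2 := h2.comp h2
  have hp : Primrec fun s : ℕ => s.unpair.1 - 1 := Primrec.nat_sub.comp h1 (Primrec.const 1)
  have hd : Primrec fun s : ℕ => 2 * s.unpair.2.unpair.2 :=
    Primrec.nat_mul.comp (Primrec.const 2) h22
  refine Primrec.ite (Primrec.eq.comp h1 (Primrec.const 0))
    (Primrec.sumInl.comp (primrec_basisCode.comp (primrec_two_pow.comp h21) h22))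
    (Primrec.sumInr.comp (Primrec.pair ?_ ?_))
  · exact Primrec₂.natPair.comp hp (Primrec₂.natPair.comp h21 hd)
  · exact Primrec₂.natPair.comp hp (Primrec₂.natPair.comp h21 (Primrec.succ.comp hd))

/-- Induction on the number `k` of bits still to read. If the bits read so far form the number `i`,
the leaves below are `i * 2^k + j` with `j < 2^k`, and the next bit is the leading bit of `j`. -/
theorem exists_treePath_basisTree (n k : ℕ) : ∀ i j : ℕ, j < 2 ^ k → ∃ p : List Bool,
    p.length = k ∧
      TreePath basisTree (basisCode (2 ^ n) (i * 2 ^ k + j)) (Nat.pair k (Nat.pair n i)) p := by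
  induction k with
  | zero =>
    intro i j hj
    obtain rfl : j = 0 := by simpa using hj
    exact ⟨[], rfl, .leaf (by simp [basisTree])⟩
  | succ k ih =>
    intro i j hj
    have hg : basisTree (Nat.pair (k + 1) (Nat.pair n i)) =
        .inr (Nat.pair k (Nat.pair n (2 * i)), Nat.pair k (Nat.pair n (2 * i + 1))) := by
      simp [basisTree]
    rcases lt_or_ge j (2 ^ k) with h | h
    · obtain ⟨p, hp, ht⟩ := ih (2 * i) j h
      refine ⟨false :: p, by simp [hp], .node hg ?_⟩
      rwa [if_neg Bool.false_ne_true, show i * 2 ^ (k + 1) + j = 2 * i * 2 ^ k + j by ring]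
    · obtain ⟨p, hp, ht⟩ := ih (2 * i + 1) (j - 2 ^ k) (by rw [pow_succ] at hj; omega)
      refine ⟨true :: p, by simp [hp], .node hg ?_⟩
      have : (2 * i + 1) * 2 ^ k = i * 2 ^ (k + 1) + 2 ^ k := by ring
      rwa [if_pos rfl, show i * 2 ^ (k + 1) + j = (2 * i + 1) * 2 ^ k + (j - 2 ^ k) by omega]

/-- Given `n`, every basis vector of the `n`-qubit space has algorithmic probability at least
`2^(-n)`, up to a constant factor. -/
theorem Machine.Universal.exists_le_algProb_ratBasis {U : Machine} (hU : U.Universal) :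
    ∃ k : ℕ, ∀ (n : ℕ) (j : Fin (2 ^ n)),
      (2⁻¹ : ℝ≥0∞) ^ (k + n) ≤ algProb U (codeVec (ratBasis j)) n := by
  obtain ⟨r, hr⟩ := hU.exists_outputs (i := fun n => Nat.pair n (Nat.pair n 0)) (g := basisTree)
    (Primrec₂.natPair.comp Primrec.id
      (Primrec₂.natPair.comp Primrec.id (Primrec.const 0))).to_comp primrec_basisTree.to_comp
  refine ⟨r.length, fun n j => ?_⟩
  obtain ⟨p, hp, ht⟩ := exists_treePath_basisTree n n 0 j j.2
  have := (hr n _ p ht).le_algProb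
  rwa [List.length_append, hp, zero_mul, zero_add, ← codeVec_ratBasis] at this

/-! ### Lower computation of the identity -/

/-- The decision tree that reads `1ⁿ0` and prints the code of the identity matrix of size
`2ⁿ * 2ⁿ`. -/
def idTree (s : ℕ) : ℕ ⊕ ℕ × ℕ :=
  if s % 2 = 0 then .inr (s + 1, s + 2) else .inl (idCode (2 ^ (s / 2) * 2 ^ (s / 2)))

theorem primrec_idTree : Primrec idTree := by
  have h : Primrec fun s : ℕ => 2 ^ (s / 2) :=
    primrec_two_pow.comp (Primrec.nat_div.comp Primrec.id (Primrec.const 2))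
  exact Primrec.ite
    (Primrec.eq.comp (Primrec.nat_mod.comp Primrec.id (Primrec.const 2)) (Primrec.const 0))
    (Primrec.sumInr.comp (Primrec.succ.pair (Primrec.succ.comp Primrec.succ)))
    (Primrec.sumInl.comp (primrec_idCode.comp (Primrec.nat_mul.comp h h)))

/-- The program `1ⁿ0`. -/
def unary (n : ℕ) : List Bool := (List.range n).map (fun _ => true) ++ [false]

theorem unary_succ (n : ℕ) : unary (n + 1) = true :: unary n := by
  simp [unary, List.range_succ_eq_map, Function.comp_def]

/-- Node `2 * m` means that `m` ones have been read; a zero leads to the leaf `2 * m + 1`, a one to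
`2 * (m + 1)`. The start `m` varies in the induction while `m + n` stays fixed. -/
theorem treePath_idTree (n : ℕ) : ∀ m : ℕ,
    TreePath idTree (idCode (2 ^ (m + n) * 2 ^ (m + n))) (2 * m) (unary n) := by
  induction n with
  | zero =>
    refine fun m => .node (a := 2 * m + 1) (b := 2 * m + 2) (by simp [idTree]) (.leaf ?_)
    simp [idTree, show (2 * m + 1) % 2 = 1 by omega, show (2 * m + 1) / 2 = m by omega]
  | succ n ih =>
    intro m
    rw [unary_succ]
    refine .node (a := 2 * m + 1) (b := 2 * (m + 1)) (by simp [idTree]; ring) ?_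
    have := ih (m + 1)
    rwa [add_assoc, add_comm 1 n] at this

theorem ratId_map_toC (N : ℕ) : (ratId N).map toC = 1 := by
  ext i j
  by_cases h : j = i
  · subst h; simp [ratId, ratBasis, toC]; rfl
  · simp [ratId, ratBasis, toC, h, Matrix.one_apply_ne' h]; rfl

/-- A program that prints the code of one elementary positive semidefinite matrix, and nothing
else, lower computes this matrix. -/
theorem lowerComputes_of_prints_iff {U : Machine} {q : List Bool} {N : ℕ}
    {E : Matrix (Fin N) (Fin N) (ℚ × ℚ)} (hE : (E.map toC).PosSemidef)
    (hb : ¬ U.ReadsBeyond 0 q) (hp : ∀ k w, U.Prints 0 q k w ↔ k = 0 ∧ w = codeMat E) :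
    LowerComputes U q (E.map toC) := by
  refine ⟨hb, fun k w h => ⟨E, ((hp k w).1 h).2, hE⟩, fun k F G _ h => ?_, fun V hV => ?_⟩
  · exact absurd ((hp _ _).1 h).1 k.succ_ne_zero
  · refine ⟨0, ⟨codeMat E, (hp _ _).2 ⟨rfl, rfl⟩⟩, fun k _ F h => ?_⟩
    rw [codeMat_injective ((hp _ _).1 h).2]
    exact mem_of_mem_nhds hV

/-- Lower computation determines the computed matrix. -/
theorem LowerComputes.unique {U : Machine} {q : List Bool} {N : ℕ}
    {σ τ : Matrix (Fin N) (Fin N) ℂ} (h : LowerComputes U q σ) (h' : LowerComputes U q τ) :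
    σ = τ := by
  by_contra hne
  obtain ⟨V, W, hV, hW, hVW⟩ := t2_separation_nhds hne
  obtain ⟨k, ⟨w, hw⟩, hk⟩ := h.2.2.2 V hV
  obtain ⟨k', ⟨w', hw'⟩, hk'⟩ := h'.2.2.2 W hW
  -- An item printed beyond both thresholds would lie in two disjoint neighbourhoods. The item at
  -- the larger threshold does exist, since lower computation requires one to be printed there.
  have key : ∀ m v, k ≤ m → k' ≤ m → U.Prints 0 q m v → False := by
    intro m v hm hm' hv
    obtain ⟨E, rfl, -⟩ := h.2.1 m v hv
    exact Set.disjoint_left.1 hVW (hk m hm E hv) (hk' m hm' E hv)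
  rcases le_total k k' with hle | hle
  · exact key k' w' hle le_rfl hw'
  · exact key k w le_rfl hle hw

theorem flatten_injective {d : ℕ} : Function.Injective (flatten (d := d)) :=
  (Matrix.reindex _ _).injective

/-- Given `n`, the identity operator on the tensor square of the `n`-qubit space has lower
algorithmic probability bounded away from zero. -/
theorem Machine.Universal.exists_le_lowerProb_one {U : Machine} (hU : U.Universal) :
    ∃ k : ℕ, ∀ n : ℕ, (∃ q, LowerComputes U q (flatten (1 : PairMatrix (2 ^ n)))) ∧
      (2⁻¹ : ℝ≥0∞) ^ k ≤ lowerProb U (1 : PairMatrix (2 ^ n)) n := by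
  have h0 : Computable fun _ : ℕ => 0 := Computable.const 0
  obtain ⟨r, hr⟩ := hU (treeMachine (fun _ => 0) idTree h0 primrec_idTree.to_comp)
  -- Lower computation has no access to `n`, so the program must carry `n` itself, in
  -- self-delimiting form.
  have hq : ∀ n, LowerComputes U (r ++ unary n) (flatten (1 : PairMatrix (2 ^ n))) := by
    intro n
    have ht : TreePath idTree (idCode (2 ^ n * 2 ^ n)) 0 (unary n) := by
      simpa using treePath_idTree n 0
    have hone : flatten (1 : PairMatrix (2 ^ n)) = (ratId (2 ^ n * 2 ^ n)).map toC := by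
      rw [ratId_map_toC]; simp [flatten]
    rw [hone]
    refine lowerComputes_of_prints_iff ?_ ?_ fun k w => ?_
    · rw [ratId_map_toC]; exact Matrix.PosSemidef.one
    · rw [(hr 0 (unary n)).2.2]
      exact TreePath.not_readsBeyond h0 primrec_idTree.to_comp ht
    · rw [(hr 0 (unary n)).2.1, TreePath.prints h0 primrec_idTree.to_comp ht, codeMat_ratId]
  -- The long program costs little: its weight is conditional on `n`, from which it is computable
  -- without reading any bit. Only the simulation prefix `s` is paid for.
  have hc : Primrec fun n => (Sum.inl (Encodable.encode (r ++ unary n)) : ℕ ⊕ ℕ × ℕ) := by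
    refine Primrec.sumInl.comp (Primrec.encode.comp (Primrec.list_append.comp (Primrec.const r)
      (Primrec.list_append.comp (Primrec.list_map Primrec.list_range ?_) (Primrec.const _))))
    exact Primrec.const true
  obtain ⟨s, hs⟩ := hU.exists_outputs Computable.id hc.to_comp
  refine ⟨s.length, fun n => ⟨⟨_, hq n⟩, ?_⟩⟩
  have := (hs n _ [] (.leaf rfl)).le_algProb
  rw [List.append_nil] at this
  exact this.trans (ENNReal.le_tsum
    (f := fun q : {q : List Bool // LowerComputes U q (flatten (1 : PairMatrix (2 ^ n)))} =>
      algProb U (Encodable.encode q.1) n) ⟨_, hq n⟩)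

/-- The lower algorithmic probability is a semi-measure. -/
theorem tsum_lowerProb_le_one (U : Machine) (n : ℕ) {d : ℕ} :
    ∑' M : PairMatrix d, lowerProb U M n ≤ 1 := by
  unfold lowerProb
  rw [← ENNReal.tsum_sigma (fun (M : PairMatrix d)
    (q : {q : List Bool // LowerComputes U q (flatten M)}) => algProb U (Encodable.encode q.1) n)]
  -- A program lower computes at most one matrix, so no code is counted twice.
  refine tsum_algProb_comp_le_one U n
    (f := fun a : Σ M : PairMatrix d, {q : List Bool // LowerComputes U q (flatten M)} =>
      Encodable.encode a.2.1) ?_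
  rintro ⟨M, q, hq⟩ ⟨M', q', hq'⟩ h
  have h1 : q = q' := Encodable.encode_injective h
  subst h1
  obtain rfl := flatten_injective (hq.unique hq')
  rfl

/-! ### Moments of the uniform distribution on the sphere -/

-- The sphere measure of `s` is a multiple of the measure of the cone `(0,1) • s`. A linear isometry
-- commutes with scaling, so it pulls the cone over `s` back to the cone over `g ⁻¹' s`.
open scoped Pointwise in
theorem measurePreserving_toSphere {E : Type*} [NormedAddCommGroup E] [NormedSpace ℝ E]
    [MeasurableSpace E] [BorelSpace E] {μ : Measure E} {f : E ≃ₗᵢ[ℝ] E}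
    (hf : MeasurePreserving f μ μ) {g : Metric.sphere (0 : E) 1 → Metric.sphere (0 : E) 1}
    (hg : ∀ x, (g x : E) = f x) : MeasurePreserving g μ.toSphere μ.toSphere := by
  have hgc : Continuous g :=
    continuous_induced_rng.2 ((f.continuous.comp continuous_subtype_val).congr fun x => (hg x).symm)
  refine ⟨hgc.measurable, Measure.ext fun s hs => ?_⟩
  rw [Measure.map_apply hgc.measurable hs, Measure.toSphere_apply' _ hs,
    Measure.toSphere_apply' _ (hgc.measurable hs)]
  congr 1
  have : Set.Ioo (0 : ℝ) 1 • (Subtype.val '' (g ⁻¹' s)) =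
      f.toHomeomorph.toMeasurableEquiv ⁻¹' (Set.Ioo (0 : ℝ) 1 • (Subtype.val '' s)) := by
    ext x
    simp only [Set.mem_smul, Set.mem_image, Set.mem_preimage]
    constructor
    · rintro ⟨r, hr, _, ⟨y, hy, rfl⟩, rfl⟩
      exact ⟨r, hr, _, ⟨g y, hy, rfl⟩, by simp [hg]⟩
    · rintro ⟨r, hr, _, ⟨y, hy, rfl⟩, hx⟩
      have hm : f.symm y ∈ Metric.sphere (0 : E) 1 := by simp
      refine ⟨r, hr, _, ⟨⟨f.symm y, hm⟩, ?_, rfl⟩, ?_⟩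
      · have : g ⟨f.symm y, hm⟩ = y := Subtype.ext (by simp [hg])
        simpa [this] using hy
      · apply f.injective
        simp only [map_smul, LinearIsometryEquiv.apply_symm_apply, hx]
        rfl
  rw [this]
  exact (MeasurePreserving.measure_preimage_equiv (f := f.toHomeomorph.toMeasurableEquiv) hf _)

instance (n : ℕ) : IsProbabilityMeasure (uniformSphere n) := by
  constructor
  rw [uniformSphere, Measure.smul_apply, smul_eq_mul]
  refine ENNReal.inv_mul_cancel ?_ (measure_ne_top _ _)
  rw [Measure.measure_univ_ne_zero]
  exact Measure.toSphere_ne_zero _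

theorem integrable_uniformSphere {n : ℕ} {F : QSphere n → ℝ} (hF : Continuous F) :
    Integrable F (uniformSphere n) :=
  hF.integrable_of_hasCompactSupport (HasCompactSupport.of_compactSpace F)

theorem measurePreserving_uniformSphere {n : ℕ}
    (f : EuclideanSpace ℂ (Fin (2 ^ n)) ≃ₗᵢ[ℂ] EuclideanSpace ℂ (Fin (2 ^ n)))
    {g : QSphere n → QSphere n} (hg : ∀ x, (g x : EuclideanSpace ℂ (Fin (2 ^ n))) = f x) :
    MeasurePreserving g (uniformSphere n) (uniformSphere n) := by
  let f' : EuclideanSpace ℂ (Fin (2 ^ n)) ≃ₗᵢ[ℝ] EuclideanSpace ℂ (Fin (2 ^ n)) :=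
    { f.toLinearEquiv.restrictScalars ℝ with norm_map' := f.norm_map }
  exact (measurePreserving_toSphere (f := f') f'.measurePreserving hg).smul_measure _

theorem integral_uniformSphere_comp {n : ℕ}
    (f : EuclideanSpace ℂ (Fin (2 ^ n)) ≃ₗᵢ[ℂ] EuclideanSpace ℂ (Fin (2 ^ n)))
    {F : EuclideanSpace ℂ (Fin (2 ^ n)) → ℝ} (hF : Continuous F) :
    ∫ ψ, F (f ψ.1) ∂uniformSphere n = ∫ ψ, F ψ.1 ∂uniformSphere n := by
  let g : QSphere n → QSphere n := fun x => ⟨f x.1, by simp⟩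
  have hg := measurePreserving_uniformSphere f (g := g) fun _ => rfl
  conv_rhs => rw [← hg.map_eq]
  rw [integral_map (f := fun ψ : QSphere n => F ψ.1) hg.measurable.aemeasurable
    (hF.comp continuous_subtype_val).aestronglyMeasurable]

/-- Extend `u` to an orthonormal basis in position `i`; the coordinate map of that basis is unitary
and its `i`-th coordinate is the inner product with `u`. -/
theorem integral_inner_pow_eq_coord {n : ℕ} (k : ℕ) (i : Fin (2 ^ n))
    {u : EuclideanSpace ℂ (Fin (2 ^ n))} (hu : ‖u‖ = 1) :
    ∫ ψ : QSphere n, ‖inner ℂ u ψ.1‖ ^ k ∂uniformSphere n =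
      ∫ ψ : QSphere n, ‖ψ.1 i‖ ^ k ∂uniformSphere n := by
  obtain ⟨b, hb⟩ := Orthonormal.exists_orthonormalBasis_extension_of_card_eq (𝕜 := ℂ)
    (E := EuclideanSpace ℂ (Fin (2 ^ n))) (ι := Fin (2 ^ n)) (by simp) (v := fun _ => u)
    (s := {i}) (by
      rw [orthonormal_iff_ite]
      rintro ⟨a, rfl⟩ ⟨b, rfl⟩
      simp [inner_self_eq_norm_sq_to_K, hu])
  have h := integral_uniformSphere_comp b.repr (F := fun x => ‖x i‖ ^ k) (by fun_prop)
  rw [← h]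
  refine integral_congr_ae (.of_forall fun ψ => ?_)
  simp only [b.repr_apply_apply, hb i rfl]

theorem integral_inner_pow_eq {n : ℕ} (k : ℕ) {u v : EuclideanSpace ℂ (Fin (2 ^ n))}
    (hu : ‖u‖ = 1) (hv : ‖v‖ = 1) :
    ∫ ψ : QSphere n, ‖inner ℂ u ψ.1‖ ^ k ∂uniformSphere n =
      ∫ ψ : QSphere n, ‖inner ℂ v ψ.1‖ ^ k ∂uniformSphere n := by
  rw [integral_inner_pow_eq_coord k ⟨0, by positivity⟩ hu,
    integral_inner_pow_eq_coord k ⟨0, by positivity⟩ hv]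

theorem sum_norm_sq_coord {n : ℕ} (ψ : QSphere n) : ∑ i, ‖ψ.1 i‖ ^ 2 = 1 := by
  rw [← EuclideanSpace.norm_sq_eq, norm_eq_of_mem_sphere]; norm_num

/-- All `2^n` coordinates have the same second moment, and their squared moduli add up to 1. -/
theorem integral_inner_sq {n : ℕ} {u : EuclideanSpace ℂ (Fin (2 ^ n))} (hu : ‖u‖ = 1) :
    ∫ ψ : QSphere n, ‖inner ℂ u ψ.1‖ ^ 2 ∂uniformSphere n = ((2 : ℝ) ^ n)⁻¹ := by
  have h : ∑ i, ∫ ψ : QSphere n, ‖ψ.1 i‖ ^ 2 ∂uniformSphere n = 1 := by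
    rw [← integral_finsetSum _ fun i _ => integrable_uniformSphere (by fun_prop)]
    simp [sum_norm_sq_coord]
  simp_rw [← integral_inner_pow_eq_coord 2 _ hu] at h
  simp only [Finset.sum_const, Finset.card_univ, Fintype.card_fin, nsmul_eq_mul] at h
  push_cast at h
  exact eq_inv_of_mul_eq_one_right h

/-- Summing `‖a + ω * b‖ ^ 4` over the fourth roots of unity `ω` removes every term that depends on
the relative phase of `a` and `b`. -/
theorem norm_add_pow_four (a b : ℂ) :
    ‖a + b‖ ^ 4 + ‖a - b‖ ^ 4 + ‖a + Complex.I * b‖ ^ 4 + ‖a - Complex.I * b‖ ^ 4 =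
      4 * ‖a‖ ^ 4 + 4 * ‖b‖ ^ 4 + 16 * (‖a‖ ^ 2 * ‖b‖ ^ 2) := by
  have h : ∀ z : ℂ, ‖z‖ ^ 4 = (z.re * z.re + z.im * z.im) ^ 2 := fun z => by
    rw [← Complex.normSq_apply, Complex.normSq_eq_norm_sq]; ring
  have h2 : ∀ z : ℂ, ‖z‖ ^ 2 = (z.re * z.re + z.im * z.im) := fun z => by
    rw [← Complex.normSq_apply, Complex.normSq_eq_norm_sq]
  simp only [h, h2]
  simp
  ring

/-- Let `m` be the common fourth moment. For `i ≠ j` each of the four polarization terms comes from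
a vector of squared norm 2 and has mean `4 * m`, so the mixed moment is exactly `m / 2`. For `i = j`
it is `m`. -/
theorem integral_coord_sq_mul_coord_sq_ge {n : ℕ} {u : EuclideanSpace ℂ (Fin (2 ^ n))}
    (hu : ‖u‖ = 1) (i j : Fin (2 ^ n)) :
    (∫ ψ : QSphere n, ‖inner ℂ u ψ.1‖ ^ 4 ∂uniformSphere n) / 2 ≤
      ∫ ψ : QSphere n, ‖ψ.1 i‖ ^ 2 * ‖ψ.1 j‖ ^ 2 ∂uniformSphere n := by
  set m := ∫ ψ : QSphere n, ‖inner ℂ u ψ.1‖ ^ 4 ∂uniformSphere n with hm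
  have hm0 : 0 ≤ m := integral_nonneg fun _ => by positivity
  have hc : ∀ i, ∫ ψ : QSphere n, ‖ψ.1 i‖ ^ 4 ∂uniformSphere n = m := fun i =>
    (integral_inner_pow_eq_coord 4 i hu).symm
  by_cases hij : i = j
  · subst hij
    have : ∀ ψ : QSphere n, ‖ψ.1 i‖ ^ 2 * ‖ψ.1 i‖ ^ 2 = ‖ψ.1 i‖ ^ 4 := fun ψ => by ring
    simp only [this, hc]
    linarith
  · have hw : ∀ ω : ℂ, ‖ω‖ = 1 →
        ∫ ψ : QSphere n, ‖ψ.1 i + ω * ψ.1 j‖ ^ 4 ∂uniformSphere n = 4 * m := by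
      intro ω hω
      -- The conjugate compensates for the conjugate linearity of the inner product in its first
      -- argument.
      set w : EuclideanSpace ℂ (Fin (2 ^ n)) :=
        EuclideanSpace.single i 1 + (starRingEnd ℂ ω) • EuclideanSpace.single j 1 with hwdef
      have hin : ∀ x : EuclideanSpace ℂ (Fin (2 ^ n)), inner ℂ w x = x i + ω * x j := fun x => by
        simp [hwdef, EuclideanSpace.inner_single_left, mul_comm]
      have hnw : ‖w‖ ^ 2 = 2 := by
        have h1 := inner_self_eq_norm_sq_to_K (𝕜 := ℂ) w
        rw [hin] at h1
        have h2 : w i + ω * w j = 2 := by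
          simp [hwdef, hij, Ne.symm hij, Complex.mul_conj, Complex.normSq_eq_norm_sq, hω]
          norm_num
        rw [h2] at h1
        exact Complex.ofReal_injective (by push_cast; exact h1.symm)
      have hn4 : ‖w‖ ^ 4 = 4 := by
        rw [show ‖w‖ ^ 4 = (‖w‖ ^ 2) ^ 2 by ring, hnw]; norm_num
      have hw0 : w ≠ 0 := fun h => by simp [h] at hnw
      have hu' : ‖((‖w‖⁻¹ : ℝ) : ℂ) • w‖ = 1 := by
        rw [norm_smul]; simp [norm_ne_zero_iff.2 hw0]
      rw [hm, integral_inner_pow_eq 4 hu hu', ← integral_const_mul]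
      refine integral_congr_ae (.of_forall fun ψ => ?_)
      simp only [inner_smul_left, norm_mul, hin, mul_pow]
      simp [hn4]
    have hI : ∀ f : QSphere n → ℝ, Continuous f → Integrable f (uniformSphere n) :=
      fun _ => integrable_uniformSphere
    have key := congrArg (fun f : QSphere n → ℝ => ∫ ψ, f ψ ∂uniformSphere n)
      (funext fun ψ : QSphere n => norm_add_pow_four (ψ.1 i) (ψ.1 j))
    simp only at key
    rw [integral_add (hI _ (by fun_prop)) (hI _ (by fun_prop)),
      integral_add (hI _ (by fun_prop)) (hI _ (by fun_prop)),
      integral_add (hI _ (by fun_prop)) (hI _ (by fun_prop)),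
      integral_add (hI _ (by fun_prop)) (hI _ (by fun_prop)),
      integral_add (hI _ (by fun_prop)) (hI _ (by fun_prop)),
      integral_const_mul, integral_const_mul, integral_const_mul, hc, hc] at key
    have h1 := hw 1 (by simp)
    have h2 := hw (-1) (by simp)
    have h3 := hw Complex.I (by simp)
    have h4 := hw (-Complex.I) (by simp)
    simp only [one_mul, neg_mul, ← sub_eq_add_neg] at h1 h2 h3 h4
    rw [h1, h2, h3, h4] at key
    linarith

/-- The `2^(2n)` mixed moments are each at least half the fourth moment, and they sum to the mean of
`(∑ ‖ψ i‖ ^ 2) ^ 2 = 1`. -/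
theorem integral_inner_pow_four_le {n : ℕ} {u : EuclideanSpace ℂ (Fin (2 ^ n))} (hu : ‖u‖ = 1) :
    ∫ ψ : QSphere n, ‖inner ℂ u ψ.1‖ ^ 4 ∂uniformSphere n ≤ 2 * (((2 : ℝ) ^ n) ^ 2)⁻¹ := by
  have h : ∑ i, ∑ j, ∫ ψ : QSphere n, ‖ψ.1 i‖ ^ 2 * ‖ψ.1 j‖ ^ 2 ∂uniformSphere n = 1 := by
    have hI : ∀ i j, Integrable (fun ψ : QSphere n => ‖ψ.1 i‖ ^ 2 * ‖ψ.1 j‖ ^ 2)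
      (uniformSphere n) := fun i j => integrable_uniformSphere (by fun_prop)
    simp_rw [← integral_finsetSum _ fun j _ => hI _ j]
    rw [← integral_finsetSum _ fun i _ => integrable_finsetSum _ fun j _ => hI i j]
    simp_rw [← Finset.mul_sum, sum_norm_sq_coord]
    simp [sum_norm_sq_coord]
  have h2 := Finset.sum_le_sum fun i (_ : i ∈ Finset.univ) => Finset.sum_le_sum
    fun j (_ : j ∈ Finset.univ) => integral_coord_sq_mul_coord_sq_ge hu i j
  rw [h] at h2
  simp only [Finset.sum_const, Finset.card_univ, Fintype.card_fin, nsmul_eq_mul] at h2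
  push_cast at h2
  rw [← div_eq_mul_inv, le_div_iff₀ (by positivity)]
  linarith

/-- After normalizing both vectors, `2xy ≤ x² + y²` reduces the mixed moment to fourth moments. -/
theorem integral_inner_sq_mul_inner_sq_le {n : ℕ} (u v : EuclideanSpace ℂ (Fin (2 ^ n))) :
    ∫ ψ : QSphere n, ‖inner ℂ u ψ.1‖ ^ 2 * ‖inner ℂ v ψ.1‖ ^ 2 ∂uniformSphere n ≤
      ‖u‖ ^ 2 * ‖v‖ ^ 2 * (2 * (((2 : ℝ) ^ n) ^ 2)⁻¹) := by
  rcases eq_or_ne u 0 with rfl | hu0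
  · simp
  rcases eq_or_ne v 0 with rfl | hv0
  · simp
  have hn : ∀ w : EuclideanSpace ℂ (Fin (2 ^ n)), w ≠ 0 → ‖((‖w‖⁻¹ : ℝ) : ℂ) • w‖ = 1 := by
    intro w hw
    rw [norm_smul]; simp [norm_ne_zero_iff.2 hw]
  have hs : ∀ w : EuclideanSpace ℂ (Fin (2 ^ n)), w ≠ 0 → ∀ x,
      ‖inner ℂ w x‖ = ‖w‖ * ‖inner ℂ (((‖w‖⁻¹ : ℝ) : ℂ) • w) x‖ := by
    intro w hw x
    rw [inner_smul_left, norm_mul]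
    simp [norm_ne_zero_iff.2 hw]
  set u' := ((‖u‖⁻¹ : ℝ) : ℂ) • u
  set v' := ((‖v‖⁻¹ : ℝ) : ℂ) • v
  have hI : ∀ f : QSphere n → ℝ, Continuous f → Integrable f (uniformSphere n) :=
    fun _ => integrable_uniformSphere
  have h1 : ∫ ψ : QSphere n, ‖inner ℂ u' ψ.1‖ ^ 2 * ‖inner ℂ v' ψ.1‖ ^ 2 ∂uniformSphere n ≤
      2 * (((2 : ℝ) ^ n) ^ 2)⁻¹ := by
    calc _ ≤ ∫ ψ : QSphere n, (2⁻¹ * ‖inner ℂ u' ψ.1‖ ^ 4 + 2⁻¹ * ‖inner ℂ v' ψ.1‖ ^ 4)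
            ∂uniformSphere n := by
          refine integral_mono (hI _ (by fun_prop)) (hI _ (by fun_prop)) fun ψ => ?_
          simp only
          nlinarith [sq_nonneg (‖inner ℂ u' ψ.1‖ ^ 2 - ‖inner ℂ v' ψ.1‖ ^ 2)]
      _ ≤ _ := by
          rw [integral_add (hI _ (by fun_prop)) (hI _ (by fun_prop)), integral_const_mul,
            integral_const_mul]
          linarith [integral_inner_pow_four_le (hn u hu0), integral_inner_pow_four_le (hn v hv0)]
  calc _ = ∫ ψ : QSphere n, ‖u‖ ^ 2 * ‖v‖ ^ 2 *
        (‖inner ℂ u' ψ.1‖ ^ 2 * ‖inner ℂ v' ψ.1‖ ^ 2) ∂uniformSphere n := by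
        refine integral_congr_ae (.of_forall fun ψ => ?_)
        simp only [hs u hu0, hs v hv0]
        ring
    _ ≤ _ := by
        rw [integral_const_mul]
        exact mul_le_mul_of_nonneg_left h1 (by positivity)

/-! ### Traces against positive semidefinite matrices -/

section Trace

open Matrix

open scoped MatrixOrder Matrix.Norms.L2Operator in
theorem exists_eq_conjTranspose_mul_self {ι : Type*} [Fintype ι] [DecidableEq ι]
    {A : Matrix ι ι ℂ} (hA : A.PosSemidef) : ∃ X : Matrix ι ι ℂ, A = Xᴴ * X :=
  CStarAlgebra.nonneg_iff_eq_star_mul_self.1 hA.nonneg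

/-- With `A = Xᴴ * X` an entry is an inner product of two columns of `X`, and each column has
squared norm at most the trace. Trace bounds thereby give entrywise absolute convergence. -/
theorem norm_apply_le_trace {ι : Type*} [Fintype ι] [DecidableEq ι] {A : Matrix ι ι ℂ}
    (hA : A.PosSemidef) (a b : ι) : ‖A a b‖ ≤ A.trace.re := by
  obtain ⟨X, rfl⟩ := exists_eq_conjTranspose_mul_self hA
  have hd : ∀ c, ((Xᴴ * X) c c).re = ∑ k, ‖X k c‖ ^ 2 := fun c => by
    rw [Matrix.mul_apply, Complex.re_sum]
    refine Finset.sum_congr rfl fun k _ => ?_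
    rw [Matrix.conjTranspose_apply, ← Complex.normSq_eq_norm_sq, ← Complex.ofReal_re
      (Complex.normSq _), Complex.normSq_eq_conj_mul_self]
    rfl
  have hle : ∀ c, ∑ k, ‖X k c‖ ^ 2 ≤ ((Xᴴ * X).trace).re := fun c => by
    rw [Matrix.trace, Complex.re_sum]
    simp only [Matrix.diag_apply, hd]
    exact Finset.single_le_sum (f := fun c => ∑ k, ‖X k c‖ ^ 2)
      (fun _ _ => Finset.sum_nonneg fun _ _ => by positivity) (Finset.mem_univ c)
  calc ‖(Xᴴ * X) a b‖ ≤ ∑ k, ‖X k a‖ * ‖X k b‖ := by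
        rw [Matrix.mul_apply]
        refine (norm_sum_le _ _).trans (Finset.sum_le_sum fun k _ => ?_)
        simp
    _ ≤ ∑ k, (2⁻¹ * ‖X k a‖ ^ 2 + 2⁻¹ * ‖X k b‖ ^ 2) :=
        Finset.sum_le_sum fun k _ => by nlinarith [sq_nonneg (‖X k a‖ - ‖X k b‖)]
    _ ≤ _ := by
        rw [Finset.sum_add_distrib, ← Finset.mul_sum, ← Finset.mul_sum]
        linarith [hle a, hle b]

theorem summable_smul_of_trace_le {ι κ : Type*} [Fintype ι] [DecidableEq ι] {w : κ → ℝ}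
    (hw0 : ∀ k, 0 ≤ w k) (hw : Summable w) {M : κ → Matrix ι ι ℂ} {K : ℝ}
    (hM : ∀ k, (M k).PosSemidef) (hK : ∀ k, (M k).trace.re ≤ K) :
    Summable fun k => w k • M k := by
  refine Pi.summable.2 fun a => Pi.summable.2 fun b => ?_
  refine Summable.of_norm_bounded (hw.mul_right K) fun k => ?_
  rw [Matrix.smul_apply, norm_smul, Real.norm_of_nonneg (hw0 k)]
  exact mul_le_mul_of_nonneg_left ((norm_apply_le_trace (hM k) a b).trans (hK k)) (hw0 k)

theorem hasSum_linearMap {ι κ : Type*} [Fintype ι] {f : κ → Matrix ι ι ℂ} (hf : Summable f)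
    (L : Matrix ι ι ℂ →ₗ[ℝ] ℝ) : HasSum (fun k => L (f k)) (L (∑' k, f k)) :=
  hf.hasSum.map L L.continuous_of_finiteDimensional

/-- The linear functional `M ↦ Re Tr (M X)`. -/
def reTrace {ι : Type*} [Fintype ι] (X : Matrix ι ι ℂ) : Matrix ι ι ℂ →ₗ[ℝ] ℝ where
  toFun M := (M * X).trace.re
  map_add' M N := by simp [add_mul]
  map_smul' r M := by simp

/-- The linear functional `M ↦ Im Tr (M X)`. -/
def imTrace {ι : Type*} [Fintype ι] (X : Matrix ι ι ℂ) : Matrix ι ι ℂ →ₗ[ℝ] ℝ where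
  toFun M := (M * X).trace.im
  map_add' M N := by simp [add_mul]
  map_smul' r M := by simp

theorem trace_ketbra_mul {N : ℕ} (v : Fin N → ℂ) (A : Matrix (Fin N) (Fin N) ℂ) :
    (ketbra v * A).trace = star v ⬝ᵥ (A *ᵥ v) := by
  rw [Matrix.trace_mul_comm, ketbra, Matrix.mul_vecMulVec, Matrix.trace_vecMulVec, dotProduct_comm]

theorem posSemidef_ketbra {N : ℕ} (v : Fin N → ℂ) : (ketbra v).PosSemidef :=
  Matrix.posSemidef_vecMulVec_self_star v

theorem trace_ketbra_mul_nonneg {N : ℕ} (v : Fin N → ℂ) {A : Matrix (Fin N) (Fin N) ℂ}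
    (hA : A.PosSemidef) : 0 ≤ (ketbra v * A).trace := by
  rw [trace_ketbra_mul]; exact hA.dotProduct_mulVec_nonneg v

theorem trace_ketbra_mul_ketbra {N : ℕ} (u v : EuclideanSpace ℂ (Fin N)) :
    (ketbra (fun i => u i) * ketbra (fun i => v i)).trace = ((‖inner ℂ u v‖ ^ 2 : ℝ) : ℂ) := by
  have h1 : (star fun i => u i) ⬝ᵥ (fun i => v i) = inner ℂ u v := by
    rw [PiLp.inner_apply]
    exact Finset.sum_congr rfl fun i _ => by simp [mul_comm]
  rw [trace_ketbra_mul, ketbra, Matrix.vecMulVec_mulVec, dotProduct_smul, h1]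
  have h2 : (star fun i => v i) ⬝ᵥ (fun i => u i) = inner ℂ v u := by
    rw [PiLp.inner_apply]
    exact Finset.sum_congr rfl fun i _ => by simp [mul_comm]
  rw [h2, ← inner_conj_symm v u, Complex.ofReal_pow, ← Complex.mul_conj']
  simp

theorem trace_ketbra {N : ℕ} (v : EuclideanSpace ℂ (Fin N)) :
    (ketbra fun i => v i).trace = ((‖v‖ ^ 2 : ℝ) : ℂ) := by
  rw [ketbra, Matrix.trace_vecMulVec, EuclideanSpace.norm_sq_eq, Complex.ofReal_sum]
  exact Finset.sum_congr rfl fun i _ => by simp [Complex.mul_conj']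

/-- A positive semidefinite matrix is a sum of operators `|x⟩⟨x|`. -/
theorem exists_eq_sum_ketbra {N : ℕ} {A : Matrix (Fin N) (Fin N) ℂ} (hA : A.PosSemidef) :
    ∃ x : Fin N → EuclideanSpace ℂ (Fin N), A = ∑ k, ketbra fun i => x k i := by
  obtain ⟨X, rfl⟩ := exists_eq_conjTranspose_mul_self hA
  refine ⟨fun k => WithLp.toLp 2 (star (X k)), ?_⟩
  ext a b
  simp [Matrix.mul_apply, Matrix.sum_apply, ketbra, Matrix.vecMulVec_apply]

end Trace

/-! ### The universal semi-density matrix -/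

/-- The unit vector of an elementary state. -/
def ElemState.toEuclidean {N : ℕ} (φ : ElemState N) : EuclideanSpace ℂ (Fin N) :=
  WithLp.toLp 2 φ.vec

theorem ElemState.norm_toEuclidean {N : ℕ} (φ : ElemState N) : ‖φ.toEuclidean‖ = 1 := by
  have h : ‖φ.toEuclidean‖ ^ 2 = 1 := by
    rw [EuclideanSpace.norm_sq_eq]
    have := congrArg (fun q : ℚ => (q : ℝ)) φ.2
    push_cast at this
    rw [← this]
    refine Finset.sum_congr rfl fun i _ => ?_
    rw [← Complex.normSq_eq_norm_sq, Complex.normSq_apply]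
    simp [toEuclidean, vec, toC, sq]
  exact (pow_eq_one_iff_of_nonneg (norm_nonneg _) two_ne_zero).1 h

theorem ElemState.trace_ketbra_vec {N : ℕ} (φ : ElemState N) : (ketbra φ.vec).trace = 1 := by
  have := trace_ketbra φ.toEuclidean
  rw [φ.norm_toEuclidean, one_pow, Complex.ofReal_one] at this
  exact this

theorem summable_algProb_codeVec (U : Machine) (N n : ℕ) :
    Summable fun φ : ElemState N => (algProb U (codeVec φ.1) n).toReal := by
  refine ENNReal.summable_toReal (ne_top_of_le_ne_top ENNReal.one_ne_top
    (tsum_algProb_comp_le_one U n (f := fun φ : ElemState N => codeVec φ.1) ?_))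
  exact fun φ χ h => Subtype.ext (codeVec_injective h)

theorem tsum_algProb_codeVec_le_one (U : Machine) (N n : ℕ) :
    ∑' φ : ElemState N, (algProb U (codeVec φ.1) n).toReal ≤ 1 := by
  have h := tsum_algProb_comp_le_one U n (f := fun φ : ElemState N => codeVec φ.1)
    fun φ χ h => Subtype.ext (codeVec_injective h)
  rw [← ENNReal.tsum_toReal_eq fun φ => ne_top_of_le_ne_top ENNReal.one_ne_top
    ((ENNReal.le_tsum φ).trans h)]
  exact ENNReal.toReal_le_of_le_ofReal zero_le_one (by simpa using h)

theorem summable_muTerm (U : Machine) (n : ℕ) : Summable (muTerm U n) :=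
  summable_smul_of_trace_le (K := 1) (fun _ => ENNReal.toReal_nonneg)
    (summable_algProb_codeVec U _ n) (fun φ => posSemidef_ketbra φ.vec)
    (fun φ => by simp [φ.trace_ketbra_vec])

theorem hasSum_mu (U : Machine) (n : ℕ) (L : Matrix (Fin (2 ^ n)) (Fin (2 ^ n)) ℂ →ₗ[ℝ] ℝ) :
    HasSum (fun φ : ElemState (2 ^ n) => (algProb U (codeVec φ.1) n).toReal * L (ketbra φ.vec))
      (L (mu U n)) := by
  simpa [muTerm, mu] using hasSum_linearMap (summable_muTerm U n) L

/-- A functional that is at most `K` on elementary pure states is at most `K` on `μ`. -/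
theorem linearMap_mu_le (U : Machine) (n : ℕ)
    (L : Matrix (Fin (2 ^ n)) (Fin (2 ^ n)) ℂ →ₗ[ℝ] ℝ) {K : ℝ} (hK : 0 ≤ K)
    (h : ∀ φ : ElemState (2 ^ n), L (ketbra φ.vec) ≤ K) : L (mu U n) ≤ K := by
  refine (hasSum_le (fun φ => mul_le_mul_of_nonneg_left (h φ) ENNReal.toReal_nonneg)
    (hasSum_mu U n L) ((summable_algProb_codeVec U _ n).hasSum.mul_right K)).trans ?_
  exact mul_le_of_le_one_left hK (tsum_algProb_codeVec_le_one U _ n)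

theorem trace_mu_re_le_one (U : Machine) (n : ℕ) : (mu U n).trace.re ≤ 1 := by
  have := linearMap_mu_le U n (reTrace 1) zero_le_one fun φ => by
    simp [reTrace, φ.trace_ketbra_vec]
  simpa [reTrace] using this

/-- Every term has a nonnegative, hence real, trace against `A`. This is needed because the real
part of a product of traces factors once one factor is real. -/
theorem trace_mu_mul_im (U : Machine) (n : ℕ) {A : Matrix (Fin (2 ^ n)) (Fin (2 ^ n)) ℂ}
    (hA : A.PosSemidef) : (mu U n * A).trace.im = 0 := by
  have h := hasSum_mu U n (imTrace A)
  have h0 : ∀ φ : ElemState (2 ^ n), imTrace A (ketbra φ.vec) = 0 := fun φ =>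
    (Complex.nonneg_iff.1 (trace_ketbra_mul_nonneg φ.vec hA)).2.symm
  simp only [h0, mul_zero] at h
  exact h.unique hasSum_zero

/-- The standard basis vectors, as elementary states. -/
def ElemState.basis {N : ℕ} (j : Fin N) : ElemState N :=
  ⟨ratBasis j, by
    rw [Finset.sum_eq_single j] <;> simp +contextual [ratBasis]⟩

theorem ElemState.basis_injective {N : ℕ} : Function.Injective (ElemState.basis (N := N)) := by
  intro i j h
  by_contra hij
  have := congrFun (congrArg Subtype.val h) i
  simp [basis, ratBasis, hij] at this

theorem ElemState.vec_basis {N : ℕ} (j : Fin N) : (ElemState.basis j).vec = Pi.single j 1 := by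
  ext i
  by_cases h : i = j
  · subst h; simp [vec, basis, ratBasis, toC]; rfl
  · simp [vec, basis, ratBasis, toC, h]; rfl

/-- `μ` dominates the maximally mixed state up to a constant factor. -/
theorem Machine.Universal.exists_le_trace_mu_mul {U : Machine} (hU : U.Universal) :
    ∃ k : ℕ, ∀ (n : ℕ) (A : Matrix (Fin (2 ^ n)) (Fin (2 ^ n)) ℂ), A.PosSemidef →
      (2⁻¹ : ℝ) ^ (k + n) * A.trace.re ≤ (mu U n * A).trace.re := by
  obtain ⟨k, hk⟩ := hU.exists_le_algProb_ratBasis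
  refine ⟨k, fun n A hA => ?_⟩
  have h := hasSum_mu U n (reTrace A)
  have h0 : ∀ φ : ElemState (2 ^ n), 0 ≤ reTrace A (ketbra φ.vec) := fun φ =>
    (Complex.nonneg_iff.1 (trace_ketbra_mul_nonneg φ.vec hA)).1
  -- All terms are nonnegative, so those outside the computational basis may be dropped; the basis
  -- terms add up to the trace of `A`.
  have h1 := tsum_comp_le_tsum_of_inj h.summable
    (fun φ => mul_nonneg ENNReal.toReal_nonneg (h0 φ)) ElemState.basis_injective
  rw [h.tsum_eq, tsum_fintype] at h1
  refine le_trans ?_ h1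
  rw [Matrix.trace, Complex.re_sum, Finset.mul_sum]
  refine Finset.sum_le_sum fun j _ => ?_
  have h2 : reTrace A (ketbra (ElemState.basis j).vec) = (A j j).re := by
    change (ketbra _ * A).trace.re = _
    rw [trace_ketbra_mul, ElemState.vec_basis]
    simp
  have h3 : (2⁻¹ : ℝ) ^ (k + n) ≤ (algProb U (codeVec (ElemState.basis j).1) n).toReal := by
    have := ENNReal.toReal_mono (ne_top_of_le_ne_top ENNReal.one_ne_top
      ((ENNReal.le_tsum _).trans (tsum_algProb_le_one U n))) (hk n j)
    simpa [ElemState.basis] using this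
  simp only [Function.comp, h2, Matrix.diag_apply]
  refine mul_le_mul_of_nonneg_right h3 ?_
  rw [← h2]
  exact h0 _

/-! ### The aggregated test -/

theorem posSemidef_of_mem_productTests {U : Machine} {n : ℕ} {M : PairMatrix (2 ^ n)}
    (hM : M ∈ productTests U n) : M.PosSemidef := by
  obtain ⟨⟨A, B, hA, hB, rfl⟩, -⟩ := hM
  exact hA.kronecker hB

/-- The test condition factors as `Tr (μA) * Tr (μB) ≤ 1`, and each factor is at least `2^(-(k+n))`
times the corresponding trace. -/
theorem Machine.Universal.exists_trace_productTests_le {U : Machine} (hU : U.Universal) :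
    ∃ k : ℕ, ∀ (n : ℕ) (A B : Matrix (Fin (2 ^ n)) (Fin (2 ^ n)) ℂ), A.PosSemidef →
      B.PosSemidef → A ⊗ₖ B ∈ productTests U n →
      A.trace.re * B.trace.re ≤ ((2 : ℝ) ^ (k + n)) ^ 2 := by
  obtain ⟨k, hk⟩ := hU.exists_le_trace_mu_mul
  refine ⟨k, fun n A B hA hB hM => ?_⟩
  have h := hM.2.2
  rw [← Matrix.mul_kronecker_mul, Matrix.trace_kronecker, Matrix.trace_mul_comm A,
    Matrix.trace_mul_comm B, Complex.mul_re, trace_mu_mul_im U n hA, zero_mul, sub_zero] at h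
  have hA0 := (Complex.nonneg_iff.1 hA.trace_nonneg).1
  have hB0 := (Complex.nonneg_iff.1 hB.trace_nonneg).1
  have h2 := (mul_le_mul (hk n A hA) (hk n B hB) (by positivity)
    (le_trans (by positivity) (hk n A hA))).trans h
  rw [inv_pow] at h2
  rw [show ((2 : ℝ) ^ (k + n))⁻¹ * A.trace.re * (((2 : ℝ) ^ (k + n))⁻¹ * B.trace.re) =
    A.trace.re * B.trace.re / ((2 : ℝ) ^ (k + n)) ^ 2 by field_simp,
    div_le_one (by positivity)] at h2
  exact h2

theorem tsum_lowerProb_productTests_le_one (U : Machine) (n : ℕ) :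
    ∑' M : productTests U n, lowerProb U M.1 n ≤ 1 :=
  (ENNReal.tsum_comp_le_tsum_of_injective Subtype.val_injective _).trans (tsum_lowerProb_le_one U n)

theorem summable_lowerProb (U : Machine) (n : ℕ) :
    Summable fun M : productTests U n => (lowerProb U M.1 n).toReal :=
  ENNReal.summable_toReal (ne_top_of_le_ne_top ENNReal.one_ne_top
    (tsum_lowerProb_productTests_le_one U n))

theorem tsum_toReal_lowerProb_le_one (U : Machine) (n : ℕ) :
    ∑' M : productTests U n, (lowerProb U M.1 n).toReal ≤ 1 := by
  have h := tsum_lowerProb_productTests_le_one U n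
  rw [← ENNReal.tsum_toReal_eq fun M => ne_top_of_le_ne_top ENNReal.one_ne_top
    ((ENNReal.le_tsum M).trans h)]
  exact ENNReal.toReal_le_of_le_ofReal zero_le_one (by simpa using h)

theorem Machine.Universal.summable_testTerm {U : Machine} (hU : U.Universal) (n : ℕ) :
    Summable (testTerm U n) := by
  obtain ⟨k, hk⟩ := hU.exists_trace_productTests_le
  refine summable_smul_of_trace_le (K := ((2 : ℝ) ^ (k + n)) ^ 2) (fun _ => ENNReal.toReal_nonneg)
    (summable_lowerProb U n) (fun M => posSemidef_of_mem_productTests M.2) ?_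
  rintro ⟨M, hM⟩
  obtain ⟨A, B, hA, hB, rfl⟩ := hM.1
  have hA0 := (Complex.nonneg_iff.1 hA.trace_nonneg).2
  simp only [Matrix.trace_kronecker, Complex.mul_re, ← hA0, zero_mul, sub_zero]
  exact hk n A B hA hB hM

theorem Machine.Universal.hasSum_aggTest {U : Machine} (hU : U.Universal) (n : ℕ)
    (L : PairMatrix (2 ^ n) →ₗ[ℝ] ℝ) :
    HasSum (fun M : productTests U n => (lowerProb U M.1 n).toReal * L M.1) (L (aggTest U n)) := by
  simpa [testTerm, aggTest] using hasSum_linearMap (hU.summable_testTerm n) L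

/-- A functional that is at most `K` on product tests is at most `K` on the aggregated test. -/
theorem Machine.Universal.linearMap_aggTest_le {U : Machine} (hU : U.Universal) (n : ℕ)
    (L : PairMatrix (2 ^ n) →ₗ[ℝ] ℝ) {K : ℝ} (hK : 0 ≤ K)
    (h : ∀ M ∈ productTests U n, L M ≤ K) : L (aggTest U n) ≤ K := by
  refine (hasSum_le (fun M : productTests U n =>
    mul_le_mul_of_nonneg_left (h M.1 M.2) ENNReal.toReal_nonneg)
    (hU.hasSum_aggTest n L) ((summable_lowerProb U n).hasSum.mul_right K)).trans ?_
  exact mul_le_of_le_one_left hK (tsum_toReal_lowerProb_le_one U n)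

/-- The aggregated test dominates the identity up to a constant factor. -/
theorem Machine.Universal.exists_le_linearMap_aggTest {U : Machine} (hU : U.Universal) :
    ∃ k : ℕ, ∀ (n : ℕ) (L : PairMatrix (2 ^ n) →ₗ[ℝ] ℝ),
      (∀ M, M.PosSemidef → 0 ≤ L M) → (2⁻¹ : ℝ) ^ k * L 1 ≤ L (aggTest U n) := by
  obtain ⟨k, hk⟩ := hU.exists_le_lowerProb_one
  refine ⟨k, fun n L hL => ?_⟩
  have h := hU.hasSum_aggTest n L
  -- The identity passes the test because the trace of `μ` is real and lies between 0 and 1.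
  have hone : (1 : PairMatrix (2 ^ n)) ∈ productTests U n := by
    refine ⟨⟨1, 1, .one, .one, by simp⟩, (hk n).1, ?_⟩
    have him := trace_mu_mul_im U n Matrix.PosSemidef.one
    rw [mul_one] at him
    have h0 : 0 ≤ (mu U n).trace.re := by
      obtain ⟨l, hl⟩ := hU.exists_le_trace_mu_mul
      have := hl n 1 .one
      rw [mul_one] at this
      refine le_trans ?_ this
      have := (Complex.nonneg_iff.1
        (Matrix.PosSemidef.one (R := ℂ) (n := Fin (2 ^ n))).trace_nonneg).1
      positivity
    rw [one_mul, Matrix.trace_kronecker, Complex.mul_re, him, zero_mul, sub_zero]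
    exact mul_le_one₀ (trace_mu_re_le_one U n) h0 (trace_mu_re_le_one U n)
  refine le_trans ?_ (le_hasSum h ⟨1, hone⟩ fun M _ =>
    mul_nonneg ENNReal.toReal_nonneg (hL _ (posSemidef_of_mem_productTests M.2)))
  refine mul_le_mul_of_nonneg_right ?_ (hL _ .one)
  have := ENNReal.toReal_mono (ne_top_of_le_ne_top ENNReal.one_ne_top
      ((ENNReal.le_tsum _).trans (tsum_lowerProb_le_one U n))) (hk n).2
  simpa using this

/-! ### Mixed and pure states -/

theorem posSemidef_pureState {n : ℕ} (ψ : QSphere n) : (pureState ψ).PosSemidef :=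
  posSemidef_ketbra _

theorem trace_pureState {n : ℕ} (ψ : QSphere n) : (pureState ψ).trace = 1 := by
  rw [pureState, trace_ketbra, norm_eq_of_mem_sphere]; simp

theorem posSemidef_maxMixed (n : ℕ) : (maxMixed n).PosSemidef := by
  refine Matrix.PosSemidef.one.smul ?_
  rw [inv_nonneg]
  positivity

theorem trace_maxMixed (n : ℕ) : (maxMixed n).trace = 1 := by
  simp [maxMixed]

theorem trace_kronecker_mul_kronecker {d : ℕ} (A B C D : Matrix (Fin d) (Fin d) ℂ) :
    ((A ⊗ₖ B) * (C ⊗ₖ D)).trace = (A * C).trace * (B * D).trace := by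
  rw [← Matrix.mul_kronecker_mul, Matrix.trace_kronecker]

theorem trace_mul_re_nonneg {ι : Type*} [Fintype ι] [DecidableEq ι] {A B : Matrix ι ι ℂ}
    (hA : A.PosSemidef) (hB : B.PosSemidef) : 0 ≤ (A * B).trace.re := by
  obtain ⟨X, rfl⟩ := exists_eq_conjTranspose_mul_self hB
  rw [← mul_assoc, Matrix.trace_mul_comm, ← mul_assoc]
  exact (Complex.nonneg_iff.1 (hA.mul_mul_conjTranspose_same X).trace_nonneg).1

theorem continuous_trace_mul_pureState {n : ℕ} (A : Matrix (Fin (2 ^ n)) (Fin (2 ^ n)) ℂ) :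
    Continuous fun ψ : QSphere n => (A * pureState ψ).trace.re := by
  simp only [Matrix.trace, Matrix.diag_apply, Matrix.mul_apply, pureState, ketbra,
    Matrix.vecMulVec_apply, Pi.star_apply]
  fun_prop

theorem continuous_trace_mul_pureState_kronecker {n : ℕ} (M : PairMatrix (2 ^ n)) :
    Continuous fun ψ : QSphere n => (M * (pureState ψ ⊗ₖ pureState ψ)).trace.re := by
  simp only [Matrix.trace, Matrix.diag_apply, Matrix.mul_apply, pureState, ketbra,
    Matrix.vecMulVec_apply, Matrix.kroneckerMap_apply, Pi.star_apply]
  fun_prop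

/-- The mean of `Tr (A |ψ⟩⟨ψ|)`. -/
def meanTrace (n : ℕ) : Matrix (Fin (2 ^ n)) (Fin (2 ^ n)) ℂ →ₗ[ℝ] ℝ where
  toFun A := ∫ ψ, reTrace (pureState ψ) A ∂uniformSphere n
  map_add' A B := by
    simp only [map_add]
    exact integral_add (integrable_uniformSphere (continuous_trace_mul_pureState A))
      (integrable_uniformSphere (continuous_trace_mul_pureState B))
  map_smul' r A := by
    simp only [map_smul, smul_eq_mul, RingHom.id_apply]
    exact integral_const_mul _ _

/-- The mean of `Tr (M (|ψ⟩⟨ψ| ⊗ |ψ⟩⟨ψ|))`. -/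
def meanPairTrace (n : ℕ) : PairMatrix (2 ^ n) →ₗ[ℝ] ℝ where
  toFun M := ∫ ψ, reTrace (pureState ψ ⊗ₖ pureState ψ) M ∂uniformSphere n
  map_add' A B := by
    simp only [map_add]
    exact integral_add (integrable_uniformSphere (continuous_trace_mul_pureState_kronecker A))
      (integrable_uniformSphere (continuous_trace_mul_pureState_kronecker B))
  map_smul' r A := by
    simp only [map_smul, smul_eq_mul, RingHom.id_apply]
    exact integral_const_mul _ _

theorem meanTrace_ketbra_vec {n : ℕ} (φ : ElemState (2 ^ n)) :
    meanTrace n (ketbra φ.vec) = ((2 : ℝ) ^ n)⁻¹ := by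
  rw [← integral_inner_sq φ.norm_toEuclidean]
  refine integral_congr_ae (.of_forall fun ψ => ?_)
  change (ketbra (fun i => φ.toEuclidean i) * ketbra fun i => ψ.1 i).trace.re = _
  rw [trace_ketbra_mul_ketbra, Complex.ofReal_re]

/-- Both factors split into rank-one operators, which turns the integrand into a double sum of
products of squared inner products; the moment bound applies term by term. -/
theorem meanPairTrace_kronecker_le {n : ℕ} {A B : Matrix (Fin (2 ^ n)) (Fin (2 ^ n)) ℂ}
    (hA : A.PosSemidef) (hB : B.PosSemidef) :
    meanPairTrace n (A ⊗ₖ B) ≤ A.trace.re * B.trace.re * (2 * (((2 : ℝ) ^ n) ^ 2)⁻¹) := by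
  obtain ⟨x, rfl⟩ := exists_eq_sum_ketbra hA
  obtain ⟨y, rfl⟩ := exists_eq_sum_ketbra hB
  have h1 : ∀ z : Fin (2 ^ n) → EuclideanSpace ℂ (Fin (2 ^ n)),
      (∑ k, ketbra fun i => z k i).trace = ((∑ k, ‖z k‖ ^ 2 : ℝ) : ℂ) := fun z => by
    rw [Matrix.trace_sum, Complex.ofReal_sum]
    exact Finset.sum_congr rfl fun k _ => trace_ketbra _
  have h2 : ∀ (z : Fin (2 ^ n) → EuclideanSpace ℂ (Fin (2 ^ n))) (ψ : QSphere n),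
      ((∑ k, ketbra fun i => z k i) * pureState ψ).trace =
        ((∑ k, ‖inner ℂ (z k) ψ.1‖ ^ 2 : ℝ) : ℂ) := fun z ψ => by
    rw [Finset.sum_mul, Matrix.trace_sum, Complex.ofReal_sum]
    exact Finset.sum_congr rfl fun k _ => trace_ketbra_mul_ketbra _ _
  have h3 : meanPairTrace n ((∑ k, ketbra fun i => x k i) ⊗ₖ (∑ k, ketbra fun i => y k i)) =
      ∫ ψ : QSphere n, ∑ k, ∑ l, ‖inner ℂ (x k) ψ.1‖ ^ 2 * ‖inner ℂ (y l) ψ.1‖ ^ 2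
        ∂uniformSphere n := by
    refine integral_congr_ae (.of_forall fun ψ => ?_)
    change (_ * (pureState ψ ⊗ₖ pureState ψ)).trace.re = _
    rw [trace_kronecker_mul_kronecker, h2, h2, ← Complex.ofReal_mul, Complex.ofReal_re,
      Finset.sum_mul_sum]
  have hI : ∀ k l, Integrable
      (fun ψ : QSphere n => ‖inner ℂ (x k) ψ.1‖ ^ 2 * ‖inner ℂ (y l) ψ.1‖ ^ 2)
      (uniformSphere n) := fun k l => integrable_uniformSphere (by fun_prop)
  rw [h3, integral_finsetSum _ fun k _ => integrable_finsetSum _ fun l _ => hI k l]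
  simp_rw [integral_finsetSum _ fun l _ => hI _ l]
  rw [h1, h1, Complex.ofReal_re, Complex.ofReal_re, Finset.sum_mul_sum, Finset.sum_mul]
  refine Finset.sum_le_sum fun k _ => ?_
  rw [Finset.sum_mul]
  exact Finset.sum_le_sum fun l _ => integral_inner_sq_mul_inner_sq_le _ _

/-! ### Entropy -/

/-- Rounding the logarithm up costs a factor between `1/2` and 1, by this lemma and the next one, so
traces can stand in for entropies. -/
theorem two_zpow_neg_ceil_le {x : ℝ} (hx : 0 < x) : (2 : ℝ) ^ (-⌈-Real.logb 2 x⌉) ≤ x := by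
  rw [← Real.rpow_intCast]
  refine (Real.rpow_le_rpow_of_exponent_le one_le_two (?_ : _ ≤ Real.logb 2 x)).trans_eq
    (Real.rpow_logb two_pos (by norm_num) hx)
  push_cast
  linarith [Int.le_ceil (-Real.logb 2 x)]

theorem le_two_zpow_neg_ceil {x : ℝ} (hx : 0 < x) : x / 2 ≤ (2 : ℝ) ^ (-⌈-Real.logb 2 x⌉) := by
  rw [← Real.rpow_intCast]
  have h : (2 : ℝ) ^ (Real.logb 2 x - 1) = x / 2 := by
    rw [Real.rpow_sub two_pos, Real.rpow_logb two_pos (by norm_num) hx, Real.rpow_one]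
  rw [← h]
  refine Real.rpow_le_rpow_of_exponent_le one_le_two ?_
  push_cast
  linarith [Int.ceil_lt_add_one (-Real.logb 2 x)]

theorem trace_mul_maxMixed (n : ℕ) (A : Matrix (Fin (2 ^ n)) (Fin (2 ^ n)) ℂ) :
    (A * maxMixed n).trace.re = ((2 : ℝ) ^ n)⁻¹ * A.trace.re := by
  rw [maxMixed, Matrix.mul_smul, mul_one, Matrix.trace_smul, smul_eq_mul,
    show ((2 : ℂ) ^ n)⁻¹ = (((2 : ℝ) ^ n)⁻¹ : ℝ) by push_cast; rfl, Complex.re_ofReal_mul]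

theorem Machine.Universal.exists_abs_entropy_maxMixed_sub_le {U : Machine} (hU : U.Universal) :
    ∃ C : ℝ, ∀ n : ℕ, |(entropy U (maxMixed n) : ℝ) - n| ≤ C := by
  obtain ⟨k, hk⟩ := hU.exists_le_trace_mu_mul
  -- The entropy lies between `n`, because the trace of `μ` is at most 1, and `n + k`, by
  -- domination.
  refine ⟨k, fun n => ?_⟩
  have hl := hk n _ (posSemidef_maxMixed n)
  rw [trace_maxMixed, Complex.one_re, mul_one] at hl
  have hu : (mu U n * maxMixed n).trace.re ≤ ((2 : ℝ) ^ n)⁻¹ := by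
    rw [trace_mul_maxMixed]
    exact mul_le_of_le_one_right (by positivity) (trace_mu_re_le_one U n)
  rw [entropy]
  set x := (mu U n * maxMixed n).trace.re
  have hx : 0 < x := lt_of_lt_of_le (by positivity) hl
  have h1 : Real.logb 2 x ≤ -n := by
    rw [Real.logb_le_iff_le_rpow one_lt_two hx, Real.rpow_neg two_pos.le, Real.rpow_natCast]
    exact hu
  have h2 : (-(k + n : ℕ) : ℝ) ≤ Real.logb 2 x := by
    rw [Real.le_logb_iff_rpow_le one_lt_two hx, Real.rpow_neg two_pos.le, Real.rpow_natCast,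
      ← inv_pow]
    exact hl
  have h3 : ((n : ℤ) : ℝ) ≤ (⌈-Real.logb 2 x⌉ : ℝ) := by
    refine le_trans ?_ (Int.le_ceil _)
    push_cast
    linarith
  have h4 : ⌈-Real.logb 2 x⌉ ≤ ((k + n : ℕ) : ℤ) := by
    rw [Int.ceil_le]
    push_cast at h2 ⊢
    linarith
  have h4' : (⌈-Real.logb 2 x⌉ : ℝ) ≤ k + n := by exact_mod_cast h4
  push_cast at h3
  rw [abs_le]
  constructor <;> linarith [(Nat.cast_nonneg k : (0 : ℝ) ≤ k)]

theorem Machine.Universal.exists_integral_two_zpow_neg_entropy {U : Machine} (hU : U.Universal) :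
    ∃ c C : ℝ, 0 < c ∧ ∀ n : ℕ,
      Integrable (fun ψ => (2 : ℝ) ^ (-entropy U (pureState ψ))) (uniformSphere n) ∧
      c * (2 : ℝ) ^ (-(n : ℤ)) ≤
        ∫ ψ, (2 : ℝ) ^ (-entropy U (pureState ψ)) ∂(uniformSphere n) ∧
      ∫ ψ, (2 : ℝ) ^ (-entropy U (pureState ψ)) ∂(uniformSphere n) ≤
        C * (2 : ℝ) ^ (-(n : ℤ)) := by
  obtain ⟨k, hk⟩ := hU.exists_le_trace_mu_mul
  -- The exponent is `k` from domination plus 1 from rounding; the upper constant is 1 because every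
  -- pure state has mean overlap exactly `2^(-n)`.
  refine ⟨(2⁻¹) ^ (k + 1), 1, by positivity, fun n => ?_⟩
  have hl : ∀ ψ : QSphere n, (2⁻¹ : ℝ) ^ (k + n) ≤ (mu U n * pureState ψ).trace.re := fun ψ => by
    simpa [trace_pureState] using hk n _ (posSemidef_pureState ψ)
  have hpos : ∀ ψ : QSphere n, 0 < (mu U n * pureState ψ).trace.re := fun ψ =>
    lt_of_lt_of_le (by positivity) (hl ψ)
  have hc := continuous_trace_mul_pureState (mu U n)
  have hint := integrable_uniformSphere hc
  have hle : ∀ ψ : QSphere n, (2 : ℝ) ^ (-entropy U (pureState ψ)) ≤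
      (mu U n * pureState ψ).trace.re := fun ψ => two_zpow_neg_ceil_le (hpos ψ)
  have hm : Measurable fun ψ : QSphere n => (2 : ℝ) ^ (-entropy U (pureState ψ)) := by
    have h1 : Measurable fun ψ : QSphere n => entropy U (pureState ψ) :=
      Int.measurable_ceil.comp ((Real.measurable_log.comp hc.measurable).div_const _).neg
    exact (measurable_from_top (f := fun z : ℤ => (2 : ℝ) ^ (-z))).comp h1
  have hI : Integrable (fun ψ => (2 : ℝ) ^ (-entropy U (pureState ψ))) (uniformSphere n) := by
    refine hint.mono' hm.aestronglyMeasurable (.of_forall fun ψ => ?_)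
    rw [Real.norm_of_nonneg (by positivity)]
    exact hle ψ
  refine ⟨hI, ?_, ?_⟩
  · calc (2⁻¹ : ℝ) ^ (k + 1) * (2 : ℝ) ^ (-(n : ℤ))
        = ∫ _ψ : QSphere n, (2⁻¹ : ℝ) ^ (k + n) / 2 ∂uniformSphere n := by
          simp only [integral_const, probReal_univ, one_smul, zpow_neg, zpow_natCast, inv_pow,
            pow_add]
          field_simp
      _ ≤ _ := integral_mono (integrable_const _) hI fun ψ =>
          (div_le_div_of_nonneg_right (hl ψ) two_pos.le).trans (le_two_zpow_neg_ceil (hpos ψ))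
  · rw [one_mul, zpow_neg, zpow_natCast]
    exact (integral_mono hI hint hle).trans (linearMap_mu_le U n (meanTrace n) (by positivity)
      fun φ => (meanTrace_ketbra_vec φ).le)

/-! ### Self-information -/

theorem Machine.Universal.exists_abs_info_maxMixed_le {U : Machine} (hU : U.Universal) :
    ∃ C : ℝ, ∀ n : ℕ, |info U (maxMixed n) (maxMixed n)| ≤ C := by
  obtain ⟨k, hk⟩ := hU.exists_trace_productTests_le
  obtain ⟨l, hl⟩ := hU.exists_le_linearMap_aggTest
  -- The upper bound `2 * k` comes from the traces of product tests, the lower bound `-l` from the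
  -- weight of the identity test.
  refine ⟨2 * k + l, fun n => ?_⟩
  have hL : ∀ A B : Matrix (Fin (2 ^ n)) (Fin (2 ^ n)) ℂ, A.PosSemidef →
      reTrace (maxMixed n ⊗ₖ maxMixed n) (A ⊗ₖ B) =
        ((2 : ℝ) ^ n)⁻¹ * A.trace.re * (((2 : ℝ) ^ n)⁻¹ * B.trace.re) := by
    intro A B hA
    change ((A ⊗ₖ B) * _).trace.re = _
    have him : (A * maxMixed n).trace.im = 0 := by
      rw [maxMixed, Matrix.mul_smul, mul_one, Matrix.trace_smul, smul_eq_mul,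
        show ((2 : ℂ) ^ n)⁻¹ = (((2 : ℝ) ^ n)⁻¹ : ℝ) by push_cast; rfl, Complex.im_ofReal_mul,
        ← (Complex.nonneg_iff.1 hA.trace_nonneg).2, mul_zero]
    rw [trace_kronecker_mul_kronecker, Complex.mul_re, him, zero_mul, sub_zero,
      trace_mul_maxMixed, trace_mul_maxMixed]
  have hu : reTrace (maxMixed n ⊗ₖ maxMixed n) (aggTest U n) ≤ (2 : ℝ) ^ (2 * k) := by
    refine hU.linearMap_aggTest_le n _ (by positivity) ?_
    intro M hM
    obtain ⟨A, B, hA, hB, rfl⟩ := hM.1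
    rw [hL A B hA]
    calc _ = A.trace.re * B.trace.re * (((2 : ℝ) ^ n) ^ 2)⁻¹ := by ring
      _ ≤ ((2 : ℝ) ^ (k + n)) ^ 2 * (((2 : ℝ) ^ n) ^ 2)⁻¹ :=
        mul_le_mul_of_nonneg_right (hk n A B hA hB hM) (by positivity)
      _ = _ := by
        rw [pow_add, mul_pow, mul_inv_cancel_right₀ (by positivity), ← pow_mul, mul_comm k]
  have hlow := hl n (reTrace (maxMixed n ⊗ₖ maxMixed n)) fun M hM =>
    trace_mul_re_nonneg hM ((posSemidef_maxMixed n).kronecker (posSemidef_maxMixed n))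
  rw [show (1 : PairMatrix (2 ^ n)) = 1 ⊗ₖ 1 by simp, hL 1 1 .one] at hlow
  simp only [Matrix.trace_one, Fintype.card_fin, Nat.cast_pow, Nat.cast_ofNat] at hlow
  rw [show ((2 : ℂ) ^ n).re = (2 : ℝ) ^ n by norm_cast, inv_mul_cancel₀ (by positivity), mul_one,
    mul_one] at hlow
  change |Real.logb 2 (reTrace (maxMixed n ⊗ₖ maxMixed n) (aggTest U n))| ≤ _
  set x := reTrace (maxMixed n ⊗ₖ maxMixed n) (aggTest U n)
  have hx : 0 < x := lt_of_lt_of_le (by positivity) hlow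
  have h1 : Real.logb 2 x ≤ (2 * k : ℕ) := by
    rw [Real.logb_le_iff_le_rpow one_lt_two hx, Real.rpow_natCast]
    exact hu
  have h2 : (-l : ℝ) ≤ Real.logb 2 x := by
    rw [Real.le_logb_iff_rpow_le one_lt_two hx, Real.rpow_neg two_pos.le, Real.rpow_natCast,
      ← inv_pow]
    exact hlow
  push_cast at h1
  rw [abs_le]
  constructor <;> linarith [(Nat.cast_nonneg k : (0 : ℝ) ≤ k), (Nat.cast_nonneg l : (0 : ℝ) ≤ l)]

/-- Domination of the identity makes the trace positive, so exponentiation really undoes the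
logarithm. The integrand is therefore continuous and linear in the test. -/
theorem Machine.Universal.two_rpow_info_pureState {U : Machine} (hU : U.Universal) {n : ℕ}
    (ψ : QSphere n) : (2 : ℝ) ^ info U (pureState ψ) (pureState ψ) =
      (aggTest U n * (pureState ψ ⊗ₖ pureState ψ)).trace.re := by
  obtain ⟨l, hl⟩ := hU.exists_le_linearMap_aggTest
  have h := hl n (reTrace (pureState ψ ⊗ₖ pureState ψ)) fun M hM =>
    trace_mul_re_nonneg hM ((posSemidef_pureState ψ).kronecker (posSemidef_pureState ψ))
  have h1 : reTrace (pureState ψ ⊗ₖ pureState ψ) 1 = 1 := by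
    simp [reTrace, Matrix.trace_kronecker, trace_pureState]
  rw [h1, mul_one] at h
  exact Real.rpow_logb two_pos (by norm_num) (lt_of_lt_of_le (by positivity) h)

theorem Machine.Universal.exists_integral_two_rpow_info_le {U : Machine} (hU : U.Universal) :
    ∃ C : ℝ, ∀ n : ℕ,
      Integrable (fun ψ => (2 : ℝ) ^ info U (pureState ψ) (pureState ψ)) (uniformSphere n) ∧
      ∫ ψ, (2 : ℝ) ^ info U (pureState ψ) (pureState ψ) ∂(uniformSphere n) ≤ C := by
  obtain ⟨k, hk⟩ := hU.exists_trace_productTests_le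
  -- The factor 2 comes from the fourth moment, `2 ^ (2 * k)` from the traces of product tests.
  refine ⟨2 * 2 ^ (2 * k), fun n => ?_⟩
  simp only [hU.two_rpow_info_pureState]
  refine ⟨integrable_uniformSphere (continuous_trace_mul_pureState_kronecker _), ?_⟩
  refine hU.linearMap_aggTest_le n (meanPairTrace n) (by positivity) ?_
  intro M hM
  obtain ⟨A, B, hA, hB, rfl⟩ := hM.1
  refine (meanPairTrace_kronecker_le hA hB).trans ?_
  calc _ ≤ ((2 : ℝ) ^ (k + n)) ^ 2 * (2 * (((2 : ℝ) ^ n) ^ 2)⁻¹) :=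
        mul_le_mul_of_nonneg_right (hk n A B hA hB hM) (by positivity)
    _ = 2 * (2 : ℝ) ^ (2 * k) := by
        rw [pow_add, mul_pow, mul_left_comm, mul_inv_cancel_right₀ (by positivity), ← pow_mul,
          mul_comm k]

/-- Markov's inequality for `2 ^ info` at level `2 ^ t`. -/
theorem Machine.Universal.exists_measure_le_info_le {U : Machine} (hU : U.Universal) :
    ∃ C : ℝ, ∀ (n : ℕ) (t : ℝ),
      (uniformSphere n).real {ψ | t ≤ info U (pureState ψ) (pureState ψ)} ≤ C * (2 : ℝ) ^ (-t) := by
  obtain ⟨C, hC⟩ := hU.exists_integral_two_rpow_info_le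
  refine ⟨C, fun n t => ?_⟩
  have h := mul_meas_ge_le_integral_of_nonneg (.of_forall fun ψ => by positivity) (hC n).1
    ((2 : ℝ) ^ t)
  have hs : {ψ : QSphere n | (2 : ℝ) ^ t ≤ (2 : ℝ) ^ info U (pureState ψ) (pureState ψ)} =
      {ψ | t ≤ info U (pureState ψ) (pureState ψ)} := by
    ext ψ
    exact Real.rpow_le_rpow_left_iff one_lt_two
  rw [hs] at h
  rw [Real.rpow_neg two_pos.le, ← div_eq_mul_inv, le_div_iff₀ (by positivity), mul_comm]
  exact h.trans (hC n).2

end QInfo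

end

theorem theorem7 (U : QInfo.Machine) (hU : U.Universal) :
    -- the series that define the universal matrix and the aggregated test converge
    (∀ n : ℕ, Summable (QInfo.muTerm U n)) ∧
    (∀ n : ℕ, Summable (QInfo.testTerm U n)) ∧
    -- entropy of the maximally mixed state
    (∃ C : ℝ, ∀ n : ℕ, |(QInfo.entropy U (QInfo.maxMixed n) : ℝ) - n| ≤ C) ∧
    -- self-information of the maximally mixed state
    (∃ C : ℝ, ∀ n : ℕ, |QInfo.info U (QInfo.maxMixed n) (QInfo.maxMixed n)| ≤ C) ∧
    -- average of two to the minus entropy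
    (∃ c C : ℝ, 0 < c ∧ ∀ n : ℕ,
      Integrable (fun ψ => (2 : ℝ) ^ (-QInfo.entropy U (QInfo.pureState ψ)))
        (QInfo.uniformSphere n) ∧
      c * (2 : ℝ) ^ (-(n : ℤ)) ≤
        ∫ ψ, (2 : ℝ) ^ (-QInfo.entropy U (QInfo.pureState ψ)) ∂(QInfo.uniformSphere n) ∧
      ∫ ψ, (2 : ℝ) ^ (-QInfo.entropy U (QInfo.pureState ψ)) ∂(QInfo.uniformSphere n) ≤
        C * (2 : ℝ) ^ (-(n : ℤ))) ∧
    -- average of two to the self-information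
    (∃ C : ℝ, ∀ n : ℕ,
      Integrable
        (fun ψ => (2 : ℝ) ^ (QInfo.info U (QInfo.pureState ψ) (QInfo.pureState ψ)))
        (QInfo.uniformSphere n) ∧
      ∫ ψ, (2 : ℝ) ^ (QInfo.info U (QInfo.pureState ψ) (QInfo.pureState ψ))
        ∂(QInfo.uniformSphere n) ≤ C) ∧
    -- hence self-information is small for most pure states
    (∃ C : ℝ, ∀ (n : ℕ) (t : ℝ),
      (QInfo.uniformSphere n).real
        {ψ | t ≤ QInfo.info U (QInfo.pureState ψ) (QInfo.pureState ψ)} ≤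
      C * (2 : ℝ) ^ (-t)) :=
  ⟨QInfo.summable_muTerm U, hU.summable_testTerm, hU.exists_abs_entropy_maxMixed_sub_le,
    hU.exists_abs_info_maxMixed_le, hU.exists_integral_two_zpow_neg_entropy,
    hU.exists_integral_two_rpow_info_le, hU.exists_measure_le_info_le⟩
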